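/- Let $S$ be a surface (a connected compact Hausdorff $2$-manifold without boundary). A polyhedral map on $S$ is a finite simple graph embedded in $S$ such that every component of its complement is an open cell whose closure is a $p$-gonal closed $2$-disc for some $p\ge 3$ (its sides being edges and its corners vertices of the graph), and any two different closures (called facets) are disjoint or meet in exactly one vertex or exactly one edge. Write $EG(\cdot)$ for the embedded graph. Let $K$ be a polyhedral map on $S$ with $n$ vertices and let $M$ be its dual map, a polyhedral map on $S$ whose vertices, edges and facets correspond to the facets, edges and vertices of $K$ with incidence reversed. Let $T$ be a proper tree on $k$ vertices in $M$, that is, a subgraph of $EG(M)$ which is a tree (connected and acyclic), has vertices $v_1,\dots,v_k$, and satisfies: 1. $\sum_{i=1}^k \deg_{EG(M)}(v_i) = n+2(k-1)$; 2. whenever two vertices $u_1,u_2$ of $T$ lie on a facet $F$ of $M$, some path joining $u_1$ and $u_2$ in the boundary cycle $\partial F$ is part of $T$; 3. every path in $T$ that lies in $\partial F$ for a facet $F$ of $M$ has length at most $\ell(\partial F)-2$, where $\ell(\partial F)$ is the number of edges of $\partial F$. Let $D\subseteq S$ be the union of the $k$ facets of $K$ that correspond to the vertices of $T$. Then $D$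 is a closed $2$-disc, and its boundary $\partial D$ is a Hamiltonian cycle of $EG(K)$. The edges of this cycle are exactly the free edges of $D$, i.e. the edges of $K$ contained in exactly one of these $k$ facets, and there are exactly $n$ of them. In particular this holds if $K$ is $\{p,q\}$-equivelar (all facets are $p$-gons and every vertex lies on exactly $q$ of them, $p,q\ge 3$), and in that case $k(p-2)=n-2$, i.e. $k=\frac{n-2}{p-2}$. -/

import Mathlib

/-- `a` is an arc in `S` with end points `x` and `y`. -/
def IsArcBetween {S : Type*} [TopologicalSpace S] (a : Set S) (x y : S) : Prop :=
  ∃ γ : unitInterval → S, Topology.IsEmbedding γ ∧ Set.range γ = a ∧ γ 0 = x ∧ γ 1 = y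

/-- `D` is a closed 2-disc embedded in `S`, and `B` is its boundary circle. -/
def IsDiscWithBoundary {S : Type*} [TopologicalSpace S] (D B : Set S) : Prop :=
  ∃ φ : Metric.closedBall (0 : ℂ) 1 → S, Topology.IsEmbedding φ ∧ Set.range φ = D ∧
    φ '' {z | ‖(z : ℂ)‖ = 1} = B

/-- The `j`-th corner of the unit disc regarded as a `p`-gon. -/
noncomputable def polygonCorner (p j : ℕ) : ℂ :=
  Complex.exp (((2 * Real.pi * j / p : ℝ) : ℂ) * Complex.I)

/-- The `j`-th side of the unit disc regarded as a `p`-gon: the closed circular arc from the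
`j`-th to the `(j+1)`-st corner. -/
noncomputable def polygonSide (p j : ℕ) : Set ℂ :=
  (fun θ : ℝ => Complex.exp ((θ : ℂ) * Complex.I)) ''
    Set.Icc (2 * Real.pi * j / p) (2 * Real.pi * (j + 1) / p)

/-- `C` is an open 2-cell whose closure is a `p`-gonal closed 2-disc: there is an embedding of the
closed unit disc that takes the open disc onto `C`, the `p` corners to points of `V` and
the `p` sides onto members of `E`. -/
def IsOpenPolygon {S : Type*} [TopologicalSpace S] (V : Set S) (E : Set (Set S)) (p : ℕ)
    (C : Set S) : Prop :=
  ∃ φ : Metric.closedBall (0 : ℂ) 1 → S, Topology.IsEmbedding φ ∧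
    φ '' {z | ‖(z : ℂ)‖ < 1} = C ∧
    (∀ j < p, ∀ z : Metric.closedBall (0 : ℂ) 1, (z : ℂ) = polygonCorner p j → φ z ∈ V) ∧
    ∀ j < p, φ '' {z | (z : ℂ) ∈ polygonSide p j} ∈ E

/-- A finite simple graph embedded in the space `S`: finitely many points, and finitely many arcs
joining them that meet only in vertices. -/
structure EmbeddedGraph (S : Type*) [TopologicalSpace S] where
  vertices : Finset S
  edges : Set (Set S)
  finite_edges : edges.Finite
  isArc : ∀ e ∈ edges, ∃ x ∈ vertices, ∃ y ∈ vertices, IsArcBetween e x y ∧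
    e ∩ (vertices : Set S) = {x, y}
  inter_subset : ∀ e ∈ edges, ∀ e' ∈ edges, e ≠ e' → e ∩ e' ⊆ (vertices : Set S)
  simple : ∀ e ∈ edges, ∀ e' ∈ edges,
    e ∩ (vertices : Set S) = e' ∩ (vertices : Set S) → e = e'

namespace EmbeddedGraph

variable {S : Type*} [TopologicalSpace S]

/-- The point set of an embedded graph. -/
def carrier (G : EmbeddedGraph S) : Set S := (G.vertices : Set S) ∪ ⋃₀ G.edges

/-- The components of the complement of the graph. -/
def regions (G : EmbeddedGraph S) : Set (Set S) :=
  {C | ∃ x ∈ G.carrierᶜ, C = connectedComponentIn G.carrierᶜ x}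

/-- The facets: closures of the components of the complement of the graph. -/
def facets (G : EmbeddedGraph S) : Set (Set S) := closure '' G.regions

/-- The abstract simple graph underlying an embedded graph. -/
def edgeGraph (G : EmbeddedGraph S) : SimpleGraph G.vertices where
  Adj u v := u ≠ v ∧ ∃ e ∈ G.edges, (u : S) ∈ e ∧ (v : S) ∈ e
  symm := ⟨fun _ _ h => ⟨h.1.symm, h.2.imp fun _ he => ⟨he.1, he.2.2, he.2.1⟩⟩⟩
  loopless := ⟨fun _ h => h.1 rfl⟩

/-- The boundary `∂F` of a facet `F`, as a subgraph of the edge graph. -/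
def boundary (G : EmbeddedGraph S) (F : Set S) : G.edgeGraph.Subgraph where
  verts := {v | (v : S) ∈ F}
  Adj u v := u ≠ v ∧ ∃ e ∈ G.edges, e ⊆ F ∧ (u : S) ∈ e ∧ (v : S) ∈ e
  adj_sub h := ⟨h.1, h.2.imp fun _ he => ⟨he.1, he.2.2⟩⟩
  edge_vert h := by
    obtain ⟨-, e, -, hF, hu, -⟩ := h
    exact hF hu
  symm := ⟨fun _ _ h => ⟨h.1.symm, h.2.imp fun _ he => ⟨he.1, he.2.1, he.2.2.2, he.2.2.1⟩⟩⟩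

/-- The length of the boundary of a facet `F`. -/
noncomputable def facetLength (G : EmbeddedGraph S) (F : Set S) : ℕ :=
  {e ∈ G.edges | e ⊆ F}.ncard

/-- The degree of a vertex in the edge graph. -/
noncomputable def degree (G : EmbeddedGraph S) (v : G.vertices) : ℕ :=
  (G.edgeGraph.neighborSet v).ncard

/-- The embedded edges (arcs in `S`) which a walk in the edge graph traverses. -/
def walkEdges (G : EmbeddedGraph S) {u v : G.vertices} (c : G.edgeGraph.Walk u v) : Set (Set S) :=
  {e ∈ G.edges | ∃ x y : G.vertices, s(x, y) ∈ c.edges ∧ (x : S) ∈ e ∧ (y : S) ∈ e}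

end EmbeddedGraph

/-- A polyhedral map on `S`: an embedded finite graph such that every component of the complement
is an open cell with a `p`-gonal closed disc, `p ≥ 3`, as its closure, and such that two different
facets are disjoint or meet in exactly a vertex or an edge. -/
structure PolyhedralMap (S : Type*) [TopologicalSpace S] extends EmbeddedGraph S where
  polygonal : ∀ C ∈ toEmbeddedGraph.regions,
    ∃ p : ℕ, 3 ≤ p ∧ IsOpenPolygon (vertices : Set S) edges p C
  polyhedral : ∀ F ∈ toEmbeddedGraph.facets, ∀ F' ∈ toEmbeddedGraph.facets, F ≠ F' →
    (F ∩ F').Nonempty → (∃ v ∈ vertices, F ∩ F' = {v}) ∨ F ∩ F' ∈ edges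

namespace PolyhedralMap

variable {S : Type*} [TopologicalSpace S]

/-- `{p, q}`-equivelar: all facets are `p`-gons, and every vertex is in exactly `q` of them. -/
def IsEquivelar (K : PolyhedralMap S) (p q : ℕ) : Prop :=
  3 ≤ p ∧ 3 ≤ q ∧ (∀ F ∈ K.facets, K.facetLength F = p) ∧
    ∀ v ∈ K.vertices, {F ∈ K.facets | v ∈ F}.ncard = q

/-- `M` is a dual map of `K`: an inclusion-reversing correspondence between the vertices, edges
and facets of `K` and the facets, edges and vertices of `M`. -/
structure Duality (K M : PolyhedralMap S) where
  vertexEquiv : K.vertices ≃ M.facets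
  edgeEquiv : K.edges ≃ M.edges
  facetEquiv : K.facets ≃ M.vertices
  mem_edge_iff : ∀ (v : K.vertices) (e : K.edges),
    (v : S) ∈ (e : Set S) ↔ (edgeEquiv e : Set S) ⊆ (vertexEquiv v : Set S)
  edge_subset_iff : ∀ (e : K.edges) (F : K.facets),
    (e : Set S) ⊆ (F : Set S) ↔ (facetEquiv F : S) ∈ (edgeEquiv e : Set S)
  mem_facet_iff : ∀ (v : K.vertices) (F : K.facets),
    (v : S) ∈ (F : Set S) ↔ (facetEquiv F : S) ∈ (vertexEquiv v : Set S)

/-- `T` is a proper tree, with respect to the number `n`, in the edge graph of `M`. -/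
structure IsProperTree (M : PolyhedralMap S) (n : ℕ) (T : M.edgeGraph.Subgraph) : Prop where
  isTree : T.coe.IsTree
  degree_sum : ((∑ᶠ v ∈ T.verts, M.degree v : ℕ) : ℤ) = n + 2 * ((T.verts.ncard : ℤ) - 1)
  joined : ∀ F ∈ M.facets, ∀ u ∈ T.verts, ∀ v ∈ T.verts, (u : S) ∈ F → (v : S) ∈ F →
    ∃ P : M.edgeGraph.Walk u v, P.IsPath ∧ P.toSubgraph ≤ M.boundary F ∧ P.toSubgraph ≤ T
  length_le : ∀ F ∈ M.facets, ∀ (u v : M.vertices) (P : M.edgeGraph.Walk u v), P.IsPath →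
    P.toSubgraph ≤ T → P.toSubgraph ≤ M.boundary F →
    (P.length : ℤ) ≤ (M.facetLength F : ℤ) - 2

namespace Duality

variable {K M : PolyhedralMap S}

/-- The facets of `K` that are dual to the vertices of `T`. -/
def dualFacets (δ : K.Duality M) (T : M.edgeGraph.Subgraph) : Set (Set S) :=
  {F | ∃ h : F ∈ K.facets, δ.facetEquiv ⟨F, h⟩ ∈ T.verts}

/-- The union `D` of the facets of `K` that are dual to the vertices of `T`. -/
def dualUnion (δ : K.Duality M) (T : M.edgeGraph.Subgraph) : Set S := ⋃₀ δ.dualFacets T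

/-- The free edges of `D`: the edges of `K` contained in exactly one of its facets. -/
def freeEdges (δ : K.Duality M) (T : M.edgeGraph.Subgraph) : Set (Set S) :=
  {e ∈ K.edges | ∃! F, F ∈ δ.dualFacets T ∧ e ⊆ F}

end Duality

end PolyhedralMap

/-! The tree is grown from one vertex by adding leaves, and at each stage the union of the dual
facets is shown to be a disc bounded by the cycle of its free edges. Suppose that a leaf `v` is
attached at `u`, and let `e` be the edge of `K` dual to `uv`. If a vertex `w` of `K` lies on the
facet of `v` and on the facet of an earlier vertex `h`, then `h` and `v` lie on the facet of `M`
dual to `w`. Condition 2 joins them by a path of the tree inside the boundary of that facet. In a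
tree this path must run through `u`, so `w` also lies on the facet of `u`, hence on `e`. As facets
of `K` meet only in vertices or edges, the new facet meets the old disc exactly in `e`
(`isPolygonalDisc_insert`).

Two discs that meet in one common boundary arc form a disc (`IsDiscWithBoundary.union`), and the new
boundary is made of the two old ones without `e`. The number of free edges therefore changes by `deg
v - 2`, and for the whole tree it is the degree sum minus `2(k - 1)`, which is `n` by condition 1.
The boundary is thus a cycle of length `n` in a graph with `n` vertices, so it is Hamiltonian. In
the equivelar case every degree in the sum is `p`, and the count becomes `k(p - 2) = n - 2`. -/

/-! ### Arcs in a Hausdorff space. -/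

/-- Replaces the subtype parametrization by a map on all of `ℝ`, constant to either side of the unit
interval, so that parameters can be rescaled freely. -/
theorem IsArcBetween.exists_path {S : Type*} [TopologicalSpace S] {a : Set S} {x y : S}
    (h : IsArcBetween a x y) :
    ∃ γ : ℝ → S, Continuous γ ∧ Set.InjOn γ (Set.Icc 0 1) ∧ γ '' Set.Icc 0 1 = a ∧
      γ 0 = x ∧ γ 1 = y := by
  obtain ⟨γ, hγ, rfl, rfl, rfl⟩ := h
  refine ⟨Set.IccExtend zero_le_one γ, hγ.continuous.Icc_extend', ?_, ?_, ?_, ?_⟩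
  · intro s hs t ht hst
    rw [Set.IccExtend_of_mem _ _ hs, Set.IccExtend_of_mem _ _ ht] at hst
    exact congrArg Subtype.val (hγ.injective hst)
  · ext z
    constructor
    · rintro ⟨t, ht, rfl⟩
      exact ⟨⟨t, ht⟩, (Set.IccExtend_of_mem _ _ ht).symm⟩
    · rintro ⟨t, rfl⟩
      exact ⟨t, t.2, Set.IccExtend_of_mem _ _ t.2⟩
  · exact Set.IccExtend_left _ _
  · exact Set.IccExtend_right _ _

/-- A continuous injection of a compact space into a Hausdorff space is a closed embedding. -/
theorem IsArcBetween.of_continuousOn {S : Type*} [TopologicalSpace S] [T2Space S] {γ : ℝ → S}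
    (hc : ContinuousOn γ (Set.Icc 0 1)) (hi : Set.InjOn γ (Set.Icc 0 1)) :
    IsArcBetween (γ '' Set.Icc 0 1) (γ 0) (γ 1) := by
  refine ⟨(Set.Icc (0 : ℝ) 1).domRestrict γ, ?_, Set.range_domRestrict _ _, rfl, rfl⟩
  exact (hc.domRestrict.isClosedEmbedding (Set.injOn_iff_injective.1 hi)).isEmbedding

theorem IsArcBetween.symm {S : Type*} [TopologicalSpace S] [T2Space S] {a : Set S} {x y : S}
    (h : IsArcBetween a x y) : IsArcBetween a y x := by
  obtain ⟨γ, hc, hi, rfl, rfl, rfl⟩ := h.exists_path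
  have key := IsArcBetween.of_continuousOn (γ := fun t => γ (1 - t)) (by fun_prop) (by
    intro s hs t ht hst
    have := hi ⟨by linarith [hs.2], by linarith [hs.1]⟩ ⟨by linarith [ht.2], by linarith [ht.1]⟩ hst
    linarith)
  have himg : (fun t => γ (1 - t)) '' Set.Icc 0 1 = γ '' Set.Icc 0 1 := by
    rw [← Set.image_image γ (fun t => 1 - t), Set.image_const_sub_Icc]
    simp
  rw [himg] at key
  simpa using key

theorem IsArcBetween.left_mem {S : Type*} [TopologicalSpace S] {a : Set S} {x y : S}
    (h : IsArcBetween a x y) : x ∈ a := by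
  obtain ⟨γ, -, rfl, rfl, -⟩ := h
  exact ⟨0, rfl⟩

theorem IsArcBetween.right_mem {S : Type*} [TopologicalSpace S] {a : Set S} {x y : S}
    (h : IsArcBetween a x y) : y ∈ a := by
  obtain ⟨γ, -, rfl, -, rfl⟩ := h
  exact ⟨1, rfl⟩

theorem IsArcBetween.ne {S : Type*} [TopologicalSpace S] {a : Set S} {x y : S}
    (h : IsArcBetween a x y) : x ≠ y := by
  obtain ⟨γ, hγ, -, rfl, rfl⟩ := h
  exact fun h => zero_ne_one (hγ.injective h)

theorem IsArcBetween.infinite {S : Type*} [TopologicalSpace S] {a : Set S} {x y : S}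
    (h : IsArcBetween a x y) : a.Infinite := by
  obtain ⟨γ, -, hi, rfl, -, -⟩ := h.exists_path
  exact (Set.Icc_infinite zero_lt_one).image hi

/-- Two arcs that share exactly one end point form an arc. -/
theorem IsArcBetween.trans {S : Type*} [TopologicalSpace S] [T2Space S] {a b : Set S} {x y z : S}
    (ha : IsArcBetween a x y) (hb : IsArcBetween b y z) (hab : a ∩ b ⊆ {y}) :
    IsArcBetween (a ∪ b) x z := by
  obtain ⟨γ, hγc, hγi, rfl, rfl, rfl⟩ := ha.exists_path
  obtain ⟨η, hηc, hηi, rfl, hη, rfl⟩ := hb.exists_path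
  set ζ : ℝ → S := fun t => if t ≤ 1 / 2 then γ (2 * t) else η (2 * t - 1) with hζ
  have h1 : ∀ t ≤ (1 / 2 : ℝ), ζ t = γ (2 * t) := fun t ht => if_pos ht
  have h2 : ∀ t : ℝ, 1 / 2 ≤ t → ζ t = η (2 * t - 1) := by
    intro t ht
    rcases ht.eq_or_lt with rfl | ht
    · rw [h1 _ le_rfl]
      norm_num [hη]
    · exact if_neg (not_le.2 ht)
  have hc : Continuous ζ := by
    refine Continuous.if_le (by fun_prop) (by fun_prop) continuous_id continuous_const ?_
    rintro t rfl
    norm_num [hη]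
  -- A coincidence between the two halves lies in `a ∩ b`, so it is the common end point, which is
  -- attained only at parameter `1 / 2`.
  have cross : ∀ s t : ℝ, 0 ≤ s → s ≤ 1 / 2 → 1 / 2 ≤ t → t ≤ 1 → ζ s = ζ t → s = t := by
    intro s t hs0 hs ht ht1 hst
    have hs' : 2 * s ∈ Set.Icc (0 : ℝ) 1 := ⟨by linarith, by linarith⟩
    have ht' : 2 * t - 1 ∈ Set.Icc (0 : ℝ) 1 := ⟨by linarith, by linarith⟩
    rw [h1 s hs, h2 t ht] at hst
    have hm : γ (2 * s) = γ 1 := hab ⟨⟨_, hs', rfl⟩, hst ▸ ⟨_, ht', rfl⟩⟩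
    have e1 := hγi hs' ⟨zero_le_one, le_rfl⟩ hm
    have e2 := hηi ht' ⟨le_rfl, zero_le_one⟩ (by rw [← hst, hm, hη])
    linarith
  have hi : Set.InjOn ζ (Set.Icc 0 1) := by
    intro s hs t ht hst
    rcases le_total s (1 / 2) with h | h <;> rcases le_total t (1 / 2) with h' | h'
    · rw [h1 s h, h1 t h'] at hst
      have := hγi ⟨by linarith [hs.1], by linarith⟩ ⟨by linarith [ht.1], by linarith⟩ hst
      linarith
    · exact cross s t hs.1 h h' ht.2 hst
    · exact (cross t s ht.1 h' h hs.2 hst.symm).symm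
    · rw [h2 s h, h2 t h'] at hst
      have := hηi ⟨by linarith, by linarith [hs.2]⟩ ⟨by linarith, by linarith [ht.2]⟩ hst
      linarith
  have key := IsArcBetween.of_continuousOn hc.continuousOn hi
  have himg : ζ '' Set.Icc 0 1 = γ '' Set.Icc 0 1 ∪ η '' Set.Icc 0 1 := by
    ext w
    constructor
    · rintro ⟨t, ht, rfl⟩
      rcases le_total t (1 / 2) with h | h
      · exact Or.inl ⟨2 * t, ⟨by linarith [ht.1], by linarith⟩, (h1 t h).symm⟩
      · exact Or.inr ⟨2 * t - 1, ⟨by linarith, by linarith [ht.2]⟩, (h2 t h).symm⟩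
    · rintro (⟨t, ht, rfl⟩ | ⟨t, ht, rfl⟩)
      · refine ⟨t / 2, ⟨by linarith [ht.1], by linarith [ht.2]⟩, ?_⟩
        rw [h1 _ (by linarith [ht.2]), mul_div_cancel₀ _ two_ne_zero]
      · refine ⟨(t + 1) / 2, ⟨by linarith [ht.1], by linarith [ht.2]⟩, ?_⟩
        rw [h2 _ (by linarith [ht.1]), mul_div_cancel₀ _ two_ne_zero, add_sub_cancel_right]
  rw [himg, h1 0 (by norm_num), h2 1 (by norm_num)] at key
  norm_num at key
  exact key

/-! ### Parametrizing and gluing closed discs. -/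

theorem IsDiscWithBoundary.of_continuousOn {S : Type*} [TopologicalSpace S] [T2Space S]
    {φ : ℂ → S} (hc : ContinuousOn φ (Metric.closedBall 0 1))
    (hi : Set.InjOn φ (Metric.closedBall 0 1)) :
    IsDiscWithBoundary (φ '' Metric.closedBall 0 1) (φ '' Metric.sphere 0 1) := by
  refine ⟨(Metric.closedBall (0 : ℂ) 1).domRestrict φ, ?_, Set.range_domRestrict _ _, ?_⟩
  · exact (hc.domRestrict.isClosedEmbedding (Set.injOn_iff_injective.1 hi)).isEmbedding
  · ext w
    constructor
    · rintro ⟨z, hz, rfl⟩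
      exact ⟨z, mem_sphere_zero_iff_norm.2 hz, rfl⟩
    · rintro ⟨z, hz, rfl⟩
      exact ⟨⟨z, Metric.sphere_subset_closedBall hz⟩, mem_sphere_zero_iff_norm.1 hz, rfl⟩

theorem Complex.mem_closedBall_one_iff {z : ℂ} :
    z ∈ Metric.closedBall (0 : ℂ) 1 ↔ z.re ^ 2 + z.im ^ 2 ≤ 1 := by
  rw [mem_closedBall_zero_iff, ← Complex.normSq_add_mul_I z.re z.im, Complex.re_add_im,
    Complex.normSq_eq_norm_sq, sq_le_one_iff₀ (norm_nonneg z)]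

theorem Complex.mem_sphere_one_iff {z : ℂ} :
    z ∈ Metric.sphere (0 : ℂ) 1 ↔ z.re ^ 2 + z.im ^ 2 = 1 := by
  rw [mem_sphere_zero_iff_norm, ← Complex.normSq_add_mul_I z.re z.im, Complex.re_add_im,
    Complex.normSq_eq_norm_sq, pow_eq_one_iff_of_nonneg (norm_nonneg z) two_ne_zero]

/-- A self-map of the circle extends radially to the closed disc. -/
theorem Complex.exists_radial_extension {h : ℂ → ℂ}
    (hc : ContinuousOn h (Metric.sphere 0 1)) (hi : Set.InjOn h (Metric.sphere 0 1))
    (hs : h '' Metric.sphere 0 1 = Metric.sphere 0 1) :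
    ∃ H : ℂ → ℂ, Continuous H ∧ Function.Injective H ∧
      H '' Metric.closedBall 0 1 = Metric.closedBall 0 1 ∧ Set.EqOn H h (Metric.sphere 0 1) := by
  set u : ℂ → ℂ := fun z => (‖z‖ : ℂ)⁻¹ * z with hu
  have hun : ∀ z, z ≠ 0 → u z ∈ Metric.sphere (0 : ℂ) 1 := by
    intro z hz
    rw [mem_sphere_zero_iff_norm, hu]
    simp [hz]
  have hur : ∀ z, (‖z‖ : ℂ) * u z = z := by
    intro z
    rcases eq_or_ne z 0 with rfl | hz
    · simp
    · rw [hu]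
      field_simp [norm_ne_zero_iff.2 hz]
  set H : ℂ → ℂ := fun z => (‖z‖ : ℂ) * h (u z) with hH
  have h1 : ∀ z ∈ Metric.sphere (0 : ℂ) 1, ‖h z‖ = 1 := fun z hz =>
    mem_sphere_zero_iff_norm.1 (hs ▸ ⟨z, hz, rfl⟩)
  have hnorm : ∀ z, ‖H z‖ = ‖z‖ := by
    intro z
    rcases eq_or_ne z 0 with rfl | hz
    · simp [hH]
    · simp [hH, h1 _ (hun z hz)]
  refine ⟨H, ?_, ?_, ?_, ?_⟩
  · rw [continuous_iff_continuousAt]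
    intro z
    rcases eq_or_ne z 0 with rfl | hz
    -- The direction `u z` has no limit at the origin; continuity there comes from `‖H z‖ = ‖z‖`.
    · have h0 : H 0 = 0 := by simp [hH]
      rw [ContinuousAt, h0, tendsto_zero_iff_norm_tendsto_zero]
      simp only [hnorm]
      exact tendsto_norm_zero
    · have hopen : IsOpen {w : ℂ | w ≠ 0} := isOpen_ne
      have hcu : ContinuousOn u {w : ℂ | w ≠ 0} := by
        refine ContinuousOn.mul (ContinuousOn.inv₀ (by fun_prop) ?_) continuousOn_id
        intro w hw
        simpa using hw
      have : ContinuousOn H {w : ℂ | w ≠ 0} :=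
        ContinuousOn.mul (by fun_prop) (hc.comp hcu hun)
      exact this.continuousAt (hopen.mem_nhds hz)
  · intro z w hzw
    have hn : ‖z‖ = ‖w‖ := by rw [← hnorm z, hzw, hnorm]
    rcases eq_or_ne z 0 with rfl | hz
    · rw [norm_zero] at hn
      exact (norm_eq_zero.1 hn.symm).symm
    · have hw : w ≠ 0 := by
        rintro rfl
        simp [hz] at hn
      have hz' : (‖z‖ : ℂ) ≠ 0 := by simpa using hz
      simp only [hH, hn] at hzw
      have := hi (hun z hz) (hun w hw) (mul_left_cancel₀ (hn ▸ hz') hzw)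
      rw [← hur z, ← hur w, this, hn]
  · ext w
    constructor
    · rintro ⟨z, hz, rfl⟩
      rw [mem_closedBall_zero_iff] at hz ⊢
      rwa [hnorm]
    · intro hw
      rcases eq_or_ne w 0 with rfl | hw0
      · exact ⟨0, hw, by simp [hH]⟩
      · obtain ⟨z, hz, hzw⟩ := hs.symm.subset (hun w hw0)
        have hz1 : ‖z‖ = 1 := mem_sphere_zero_iff_norm.1 hz
        refine ⟨(‖w‖ : ℂ) * z, ?_, ?_⟩
        · rw [mem_closedBall_zero_iff] at hw ⊢
          simpa [hz1] using hw
        · have : u ((‖w‖ : ℂ) * z) = z := by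
            have : (‖w‖ : ℂ) ≠ 0 := by simpa using hw0
            simp only [hu, norm_mul, hz1]
            simp [this]
          simp only [hH, this, hzw]
          simp [hz1, hur]
  · intro z hz
    have : ‖z‖ = 1 := mem_sphere_zero_iff_norm.1 hz
    simp [hH, hu, this]

/-- Functions on the upper and on the lower half of a closed set that agree on the real axis
can be pasted. -/
theorem ContinuousOn.exists_paste {S : Type*} [TopologicalSpace S] {s : Set ℂ} (hs : IsClosed s)
    {f g : ℂ → S} (hf : ContinuousOn f (s ∩ {z | 0 ≤ z.im}))
    (hg : ContinuousOn g (s ∩ {z | z.im ≤ 0})) (hfg : ∀ z ∈ s, z.im = 0 → f z = g z) :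
    ∃ F : ℂ → S, ContinuousOn F s ∧ (∀ z ∈ s, 0 ≤ z.im → F z = f z) ∧
      ∀ z ∈ s, z.im ≤ 0 → F z = g z := by
  set F : ℂ → S := fun z => if 0 ≤ z.im then f z else g z with hF
  have h1 : ∀ z ∈ s, 0 ≤ z.im → F z = f z := fun z _ h => if_pos h
  have h2 : ∀ z ∈ s, z.im ≤ 0 → F z = g z := by
    intro z hz h
    rcases h.eq_or_lt with h' | h'
    · rw [h1 z hz h'.ge, hfg z hz h']
    · exact if_neg (not_le.2 h')
  refine ⟨F, ?_, h1, h2⟩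
  have hu : s = (s ∩ {z | 0 ≤ z.im}) ∪ (s ∩ {z | z.im ≤ 0}) := by
    ext z
    have := le_total 0 z.im
    simp only [Set.mem_union, Set.mem_inter_iff, Set.mem_ofPred_eq]
    tauto
  rw [hu]
  refine ContinuousOn.union_of_isClosed (hf.congr fun z hz => h1 z hz.1 hz.2)
    (hg.congr fun z hz => h2 z hz.1 hz.2) ?_ ?_
  · exact hs.inter (isClosed_le continuous_const Complex.continuous_im)
  · exact hs.inter (isClosed_le Complex.continuous_im continuous_const)

/-- A disc whose boundary consists of two arcs has a parametrization that agrees with given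
parametrizations of the arcs on the upper and on the lower half circle. -/
theorem IsDiscWithBoundary.exists_param {S : Type*} [TopologicalSpace S] {D : Set S} {γ η : ℝ → S}
    (hγc : Continuous γ) (hγi : Set.InjOn γ (Set.Icc 0 1))
    (hηc : Continuous η) (hηi : Set.InjOn η (Set.Icc 0 1)) (h0 : γ 0 = η 0) (h1 : γ 1 = η 1)
    (hinter : γ '' Set.Icc 0 1 ∩ η '' Set.Icc 0 1 ⊆ {γ 0, γ 1})
    (hD : IsDiscWithBoundary D (γ '' Set.Icc 0 1 ∪ η '' Set.Icc 0 1)) :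
    ∃ ψ : ℂ → S, ContinuousOn ψ (Metric.closedBall 0 1) ∧ Set.InjOn ψ (Metric.closedBall 0 1) ∧
      ψ '' Metric.closedBall 0 1 = D ∧
      (∀ z ∈ Metric.sphere (0 : ℂ) 1, 0 ≤ z.im → ψ z = γ ((z.re + 1) / 2)) ∧
      ∀ z ∈ Metric.sphere (0 : ℂ) 1, z.im ≤ 0 → ψ z = η ((z.re + 1) / 2) := by
  obtain ⟨φ, hφ, rfl, hφB⟩ := hD
  have hre : ∀ z ∈ Metric.sphere (0 : ℂ) 1, (z.re + 1) / 2 ∈ Set.Icc (0 : ℝ) 1 := by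
    intro z hz
    rw [Complex.mem_sphere_one_iff] at hz
    constructor <;> nlinarith [sq_nonneg z.im]
  have hone : ∀ z ∈ Metric.sphere (0 : ℂ) 1, z.im = 0 → z.re = 1 ∨ z.re = -1 := by
    intro z hz h
    rw [Complex.mem_sphere_one_iff, h] at hz
    exact mul_self_eq_one_iff.1 (by linarith)
  -- `k` is the wanted parametrization of the boundary circle: each half circle is projected to the
  -- real axis, and `[-1, 1]` is rescaled to `[0, 1]`.
  obtain ⟨k, hkc, hk1, hk2⟩ := ContinuousOn.exists_paste (s := Metric.sphere (0 : ℂ) 1)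
    Metric.isClosed_sphere (f := fun z => γ ((z.re + 1) / 2)) (g := fun z => η ((z.re + 1) / 2))
    (by fun_prop) (by fun_prop) (by
      intro z hz h
      rcases hone z hz h with h | h <;> norm_num [h, h0, h1])
  have hkcross : ∀ z ∈ Metric.sphere (0 : ℂ) 1, ∀ w ∈ Metric.sphere (0 : ℂ) 1,
      0 ≤ z.im → w.im ≤ 0 → k z = k w → z = w := by
    intro z hz w hw hz0 hw0 h
    rw [hk1 z hz hz0, hk2 w hw hw0] at h
    have hmem : γ ((z.re + 1) / 2) ∈ ({γ 0, γ 1} : Set S) :=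
      hinter ⟨⟨_, hre z hz, rfl⟩, h ▸ ⟨_, hre w hw, rfl⟩⟩
    rw [Complex.mem_sphere_one_iff] at hz hw
    rcases hmem with h' | h'
    · have e1 := hγi (hre z (Complex.mem_sphere_one_iff.2 hz)) (by simp) h'
      have e2 := hηi (hre w (Complex.mem_sphere_one_iff.2 hw)) (by simp)
        (h.symm.trans (h'.trans h0))
      have e3 : z.re = -1 := by linarith
      have e4 : w.re = -1 := by linarith
      rw [e3] at hz
      rw [e4] at hw
      exact Complex.ext (by rw [e3, e4])
        ((pow_eq_zero_iff two_ne_zero).1 (by linarith : z.im ^ 2 = 0) |>.trans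
          ((pow_eq_zero_iff two_ne_zero).1 (by linarith : w.im ^ 2 = 0)).symm)
    · have e1 := hγi (hre z (Complex.mem_sphere_one_iff.2 hz)) (by simp) h'
      have e2 := hηi (hre w (Complex.mem_sphere_one_iff.2 hw)) (by simp)
        (h.symm.trans (h'.trans h1))
      have e3 : z.re = 1 := by linarith
      have e4 : w.re = 1 := by linarith
      rw [e3] at hz
      rw [e4] at hw
      exact Complex.ext (by rw [e3, e4])
        ((pow_eq_zero_iff two_ne_zero).1 (by linarith : z.im ^ 2 = 0) |>.trans
          ((pow_eq_zero_iff two_ne_zero).1 (by linarith : w.im ^ 2 = 0)).symm)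
  have hki : Set.InjOn k (Metric.sphere 0 1) := by
    intro z hz w hw h
    rcases le_total 0 z.im with hz0 | hz0 <;> rcases le_total 0 w.im with hw0 | hw0
    · have h' := h
      rw [hk1 z hz hz0, hk1 w hw hw0] at h'
      have e := hγi (hre z hz) (hre w hw) h'
      have e' : z.re = w.re := by linarith
      rw [Complex.mem_sphere_one_iff] at hz hw
      refine Complex.ext e' ((sq_eq_sq₀ hz0 hw0).1 ?_)
      rw [e'] at hz
      linarith
    · exact hkcross z hz w hw hz0 hw0 h
    · exact (hkcross w hw z hz hw0 hz0 h.symm).symm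
    · have h' := h
      rw [hk2 z hz hz0, hk2 w hw hw0] at h'
      have e := hηi (hre z hz) (hre w hw) h'
      have e' : z.re = w.re := by linarith
      rw [Complex.mem_sphere_one_iff] at hz hw
      refine Complex.ext e' (neg_inj.1 ((sq_eq_sq₀ (neg_nonneg.2 hz0) (neg_nonneg.2 hw0)).1 ?_))
      rw [e'] at hz
      linarith
  have hks : k '' Metric.sphere 0 1 = γ '' Set.Icc 0 1 ∪ η '' Set.Icc 0 1 := by
    have hpt : ∀ t ∈ Set.Icc (0 : ℝ) 1, 0 ≤ 1 - (2 * t - 1) ^ 2 := by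
      intro t ht
      nlinarith [ht.1, ht.2]
    ext w
    constructor
    · rintro ⟨z, hz, rfl⟩
      rcases le_total 0 z.im with h | h
      · exact Or.inl ⟨_, hre z hz, (hk1 z hz h).symm⟩
      · exact Or.inr ⟨_, hre z hz, (hk2 z hz h).symm⟩
    · rintro (⟨t, ht, rfl⟩ | ⟨t, ht, rfl⟩)
      · have hm : (⟨2 * t - 1, √(1 - (2 * t - 1) ^ 2)⟩ : ℂ) ∈ Metric.sphere (0 : ℂ) 1 := by
          rw [Complex.mem_sphere_one_iff]
          simp [Real.sq_sqrt (hpt t ht)]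
        refine ⟨_, hm, (hk1 _ hm (Real.sqrt_nonneg _)).trans ?_⟩
        simp
      · have hm : (⟨2 * t - 1, -√(1 - (2 * t - 1) ^ 2)⟩ : ℂ) ∈ Metric.sphere (0 : ℂ) 1 := by
          rw [Complex.mem_sphere_one_iff]
          simp [Real.sq_sqrt (hpt t ht)]
        refine ⟨_, hm, (hk2 _ hm (neg_nonpos.2 (Real.sqrt_nonneg _))).trans ?_⟩
        simp
  -- `h` will be `φ⁻¹ ∘ k`, a bijection of the unit circle. Precomposing `φ` with its radial
  -- extension `H` corrects the boundary values to `k` without changing the image.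
  have hex : ∀ z : Metric.sphere (0 : ℂ) 1, ∃ w : Metric.closedBall (0 : ℂ) 1,
      ‖(w : ℂ)‖ = 1 ∧ φ w = k z := by
    intro z
    have : k z ∈ φ '' {z | ‖(z : ℂ)‖ = 1} := by
      rw [hφB, ← hks]
      exact ⟨z, z.2, rfl⟩
    exact this
  choose h hh1 hh2 using hex
  have hhc : Continuous h := by
    rw [hφ.continuous_iff]
    refine (hkc.domRestrict).congr fun z => (hh2 z).symm
  set h' : ℂ → ℂ := Function.extend Subtype.val (fun z => (h z : ℂ)) 0 with hh'
  have hh'v : ∀ z : Metric.sphere (0 : ℂ) 1, h' z = h z := fun z =>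
    Subtype.val_injective.extend_apply _ _ z
  obtain ⟨H, hHc, hHi, hHs, hHh⟩ := Complex.exists_radial_extension (h := h') (by
      rw [continuousOn_iff_continuous_domRestrict]
      exact (continuous_subtype_val.comp hhc).congr fun z => (hh'v z).symm)
    (by
      intro z hz w hw hzw
      rw [hh'v ⟨z, hz⟩, hh'v ⟨w, hw⟩] at hzw
      refine hki hz hw ?_
      rw [← hh2 ⟨z, hz⟩, ← hh2 ⟨w, hw⟩, Subtype.ext hzw])
    (by
      ext w
      constructor
      · rintro ⟨z, hz, rfl⟩
        rw [hh'v ⟨z, hz⟩, mem_sphere_zero_iff_norm, hh1]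
      · intro hw
        have : φ ⟨w, Metric.sphere_subset_closedBall hw⟩ ∈ k '' Metric.sphere 0 1 := by
          rw [hks, ← hφB]
          exact ⟨_, mem_sphere_zero_iff_norm.1 hw, rfl⟩
        obtain ⟨z, hz, hzw⟩ := this
        refine ⟨z, hz, ?_⟩
        rw [hh'v ⟨z, hz⟩]
        rw [← hh2 ⟨z, hz⟩] at hzw
        exact congrArg Subtype.val (hφ.injective hzw))
  set φ' : ℂ → S := Function.extend Subtype.val φ (fun _ => γ 0) with hφ'
  have hφ'v : ∀ z : Metric.closedBall (0 : ℂ) 1, φ' z = φ z := fun z =>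
    Subtype.val_injective.extend_apply _ _ z
  have hφ'c : ContinuousOn φ' (Metric.closedBall 0 1) := by
    rw [continuousOn_iff_continuous_domRestrict]
    exact hφ.continuous.congr fun z => (hφ'v z).symm
  have hHm : Set.MapsTo H (Metric.closedBall 0 1) (Metric.closedBall 0 1) := fun z hz =>
    hHs.subset ⟨z, hz, rfl⟩
  have hψ : ∀ z ∈ Metric.sphere (0 : ℂ) 1, φ' (H z) = k z := by
    intro z hz
    rw [hHh hz, hh'v ⟨z, hz⟩, hφ'v, hh2]
  refine ⟨φ' ∘ H, hφ'c.comp hHc.continuousOn hHm, ?_, ?_, ?_, ?_⟩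
  · intro z hz w hw hzw
    simp only [Function.comp, hφ'v ⟨H z, hHm hz⟩, hφ'v ⟨H w, hHm hw⟩] at hzw
    exact hHi (congrArg Subtype.val (hφ.injective hzw))
  · rw [Set.image_comp, hHs]
    ext w
    constructor
    · rintro ⟨z, hz, rfl⟩
      exact ⟨⟨z, hz⟩, (hφ'v ⟨z, hz⟩).symm⟩
    · rintro ⟨z, rfl⟩
      exact ⟨z, z.2, hφ'v z⟩
  · exact fun z hz hz0 => (hψ z hz).trans (hk1 z hz hz0)
  · exact fun z hz hz0 => (hψ z hz).trans (hk2 z hz hz0)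

/-- Two discs that meet exactly in a common boundary arc form a disc. -/
theorem IsDiscWithBoundary.union {S : Type*} [TopologicalSpace S] [T2Space S]
    {D₁ D₂ a₁ a₂ e : Set S} {x y : S} (he : IsArcBetween e x y)
    (ha₁ : IsArcBetween a₁ x y) (ha₂ : IsArcBetween a₂ x y)
    (hae₁ : a₁ ∩ e ⊆ {x, y}) (hae₂ : a₂ ∩ e ⊆ {x, y})
    (hD₁ : IsDiscWithBoundary D₁ (a₁ ∪ e)) (hD₂ : IsDiscWithBoundary D₂ (a₂ ∪ e))
    (hD : D₁ ∩ D₂ = e) : IsDiscWithBoundary (D₁ ∪ D₂) (a₁ ∪ a₂) := by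
  obtain ⟨ε, hεc, hεi, rfl, rfl, rfl⟩ := he.exists_path
  obtain ⟨α, hαc, hαi, rfl, hα0, hα1⟩ := ha₁.exists_path
  obtain ⟨β, hβc, hβi, rfl, hβ0, hβ1⟩ := ha₂.exists_path
  obtain ⟨ψ₁, hψ₁c, hψ₁i, hψ₁D, hψ₁u, hψ₁l⟩ := IsDiscWithBoundary.exists_param hαc hαi hεc hεi
    hα0 hα1 (by rwa [hα0, hα1]) hD₁
  obtain ⟨ψ₂, hψ₂c, hψ₂i, hψ₂D, hψ₂u, hψ₂l⟩ := IsDiscWithBoundary.exists_param hεc hεi hβc hβi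
    hβ0.symm hβ1.symm (by rwa [Set.inter_comm]) (by rwa [Set.union_comm])
  -- Half the length of the vertical chord of the unit disc through `z`.
  set s : ℂ → ℝ := fun z => √(1 - z.re ^ 2) with hs
  have hsc : Continuous s := by fun_prop
  have hsn : ∀ z, 0 ≤ s z := fun z => Real.sqrt_nonneg _
  have hball : ∀ z, z ∈ Metric.closedBall (0 : ℂ) 1 → s z ^ 2 = 1 - z.re ^ 2 := by
    intro z hz
    rw [Complex.mem_closedBall_one_iff] at hz
    exact Real.sq_sqrt (by nlinarith [sq_nonneg z.im])
  have habs : ∀ z, z ∈ Metric.closedBall (0 : ℂ) 1 → -s z ≤ z.im ∧ z.im ≤ s z := by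
    intro z hz
    have := hball z hz
    rw [Complex.mem_closedBall_one_iff] at hz
    exact abs_le.1 (abs_le_of_sq_le_sq (by linarith) (hsn z))
  have hmem : ∀ z ∈ Metric.closedBall (0 : ℂ) 1, ∀ v : ℝ, -s z ≤ v → v ≤ s z →
      (⟨z.re, v⟩ : ℂ) ∈ Metric.closedBall (0 : ℂ) 1 := by
    intro z hz v h1 h2
    rw [Complex.mem_closedBall_one_iff]
    have := sq_le_sq' h1 h2
    have := hball z hz
    dsimp only
    linarith
  have hsph : ∀ z ∈ Metric.closedBall (0 : ℂ) 1, ∀ v : ℝ, v ^ 2 = s z ^ 2 →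
      (⟨z.re, v⟩ : ℂ) ∈ Metric.sphere (0 : ℂ) 1 := by
    intro z hz v h1
    rw [Complex.mem_sphere_one_iff]
    dsimp only
    rw [h1, hball z hz]
    ring
  -- `up` stretches each vertical half chord of the upper half disc onto the whole chord: the upper
  -- semicircle stays fixed and the diameter goes to the lower semicircle. `lo` mirrors this. Thus
  -- `ψ₁` fills the upper half, `ψ₂` the lower half, and `e` becomes the diameter.
  set up : ℂ → ℂ := fun z => ⟨z.re, 2 * z.im - s z⟩ with hup
  set lo : ℂ → ℂ := fun z => ⟨z.re, 2 * z.im + s z⟩ with hlo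
  have hcmk : ∀ f : ℂ → ℝ, Continuous f → Continuous fun z : ℂ => (⟨z.re, f z⟩ : ℂ) := by
    intro f hf
    simp only [Complex.mk_eq_add_mul_I]
    fun_prop
  have hupc : Continuous up := hcmk _ (by fun_prop)
  have hloc : Continuous lo := hcmk _ (by fun_prop)
  have hupm : ∀ z ∈ Metric.closedBall (0 : ℂ) 1, 0 ≤ z.im →
      up z ∈ Metric.closedBall (0 : ℂ) 1 := fun z hz h0 =>
    hmem z hz _ (by linarith) (by linarith [habs z hz])
  have hlom : ∀ z ∈ Metric.closedBall (0 : ℂ) 1, z.im ≤ 0 →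
      lo z ∈ Metric.closedBall (0 : ℂ) 1 := fun z hz h0 =>
    hmem z hz _ (by linarith [habs z hz]) (by linarith)
  obtain ⟨ψ, hψc, hψu, hψl⟩ := ContinuousOn.exists_paste (s := Metric.closedBall (0 : ℂ) 1)
    Metric.isClosed_closedBall (f := ψ₁ ∘ up) (g := ψ₂ ∘ lo)
    (hψ₁c.comp hupc.continuousOn fun z hz => hupm z hz.1 hz.2)
    (hψ₂c.comp hloc.continuousOn fun z hz => hlom z hz.1 hz.2) (by
      intro z hz h
      have e1 := hψ₁l (up z) (hsph z hz _ (by rw [h]; ring)) (by simp [hup, h, hsn])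
      have e2 := hψ₂u (lo z) (hsph z hz _ (by rw [h]; ring)) (by simp [hlo, h, hsn])
      exact e1.trans e2.symm)
  have hext : ∀ z w : ℂ, z.re = w.re → s z = s w := by
    intro z w h
    simp only [hs, h]
  have hpt : ∀ t ∈ Set.Icc (0 : ℝ) 1, 0 ≤ 1 - (2 * t - 1) ^ 2 := by
    intro t ht
    nlinarith [ht.1, ht.2]
  have hptu : ∀ t ∈ Set.Icc (0 : ℝ) 1,
      (⟨2 * t - 1, √(1 - (2 * t - 1) ^ 2)⟩ : ℂ) ∈ Metric.sphere (0 : ℂ) 1 := by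
    intro t ht
    rw [Complex.mem_sphere_one_iff]
    simp [Real.sq_sqrt (hpt t ht)]
  have hptl : ∀ t ∈ Set.Icc (0 : ℝ) 1,
      (⟨2 * t - 1, -√(1 - (2 * t - 1) ^ 2)⟩ : ℂ) ∈ Metric.sphere (0 : ℂ) 1 := by
    intro t ht
    rw [Complex.mem_sphere_one_iff]
    simp [Real.sq_sqrt (hpt t ht)]
  have hhalf : ∀ t : ℝ, (2 * t - 1 + 1) / 2 = t := fun t => by ring
  have hedge₂ : ∀ u ∈ Metric.closedBall (0 : ℂ) 1, ∀ t ∈ Set.Icc (0 : ℝ) 1, ε t = ψ₂ u →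
      u.im = s u := by
    intro u hu t ht h
    have e1 := hψ₂u _ (hptu t ht) (Real.sqrt_nonneg _)
    rw [hhalf] at e1
    rw [← hψ₂i (Metric.sphere_subset_closedBall (hptu t ht)) hu (e1.trans h)]
  have hupper : ∀ z ∈ Metric.closedBall (0 : ℂ) 1, ∀ w ∈ Metric.closedBall (0 : ℂ) 1,
      0 ≤ z.im → 0 ≤ w.im → ψ z = ψ w → z = w := by
    intro z hz w hw hz0 hw0 h
    rw [hψu z hz hz0, hψu w hw hw0] at h
    obtain ⟨e1, e2⟩ := Complex.ext_iff.1 (hψ₁i (hupm z hz hz0) (hupm w hw hw0) h)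
    simp only [hup] at e1 e2
    exact Complex.ext e1 (by linarith [hext z w e1])
  have hlower : ∀ z ∈ Metric.closedBall (0 : ℂ) 1, ∀ w ∈ Metric.closedBall (0 : ℂ) 1,
      z.im ≤ 0 → w.im ≤ 0 → ψ z = ψ w → z = w := by
    intro z hz w hw hz0 hw0 h
    rw [hψl z hz hz0, hψl w hw hw0] at h
    obtain ⟨e1, e2⟩ := Complex.ext_iff.1 (hψ₂i (hlom z hz hz0) (hlom w hw hw0) h)
    simp only [hlo] at e1 e2
    exact Complex.ext e1 (by linarith [hext z w e1])
  -- A common value lies in `D₁ ∩ D₂ = e`, so `lo w` is on the upper semicircle. This forces `w`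
  -- onto the diameter and reduces to injectivity on the upper half.
  have hcross : ∀ z ∈ Metric.closedBall (0 : ℂ) 1, ∀ w ∈ Metric.closedBall (0 : ℂ) 1,
      0 ≤ z.im → w.im ≤ 0 → ψ z = ψ w → z = w := by
    intro z hz w hw hz0 hw0 h
    have h' := h
    rw [hψu z hz hz0, hψl w hw hw0] at h'
    have hm : ψ₁ (up z) ∈ D₁ ∩ D₂ :=
      ⟨hψ₁D ▸ ⟨_, hupm z hz hz0, rfl⟩, hψ₂D ▸ ⟨lo w, hlom w hw hw0, h'.symm⟩⟩
    rw [hD] at hm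
    obtain ⟨t, ht, hts⟩ := hm
    have e2 := hedge₂ _ (hlom w hw hw0) t ht (hts.trans h')
    have e2' : 2 * w.im + s w = s w := e2
    exact hupper z hz w hw hz0 (by linarith) h
  have hψi : Set.InjOn ψ (Metric.closedBall 0 1) := by
    intro z hz w hw h
    rcases le_total 0 z.im with hz0 | hz0 <;> rcases le_total 0 w.im with hw0 | hw0
    · exact hupper z hz w hw hz0 hw0 h
    · exact hcross z hz w hw hz0 hw0 h
    · exact (hcross w hw z hz hw0 hz0 h.symm).symm
    · exact hlower z hz w hw hz0 hw0 h
  have hsu : ∀ z ∈ Metric.sphere (0 : ℂ) 1, 0 ≤ z.im → up z = z := by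
    intro z hz h
    have h1 := hball z (Metric.sphere_subset_closedBall hz)
    rw [Complex.mem_sphere_one_iff] at hz
    have h2 : z.im = s z := (sq_eq_sq₀ h (hsn z)).1 (by linarith)
    exact Complex.ext rfl (by simp only [hup]; linarith)
  have hsl : ∀ z ∈ Metric.sphere (0 : ℂ) 1, z.im ≤ 0 → lo z = z := by
    intro z hz h
    have h1 := hball z (Metric.sphere_subset_closedBall hz)
    rw [Complex.mem_sphere_one_iff] at hz
    have h2 : -z.im = s z := (sq_eq_sq₀ (neg_nonneg.2 h) (hsn z)).1 (by linarith)
    exact Complex.ext rfl (by simp only [hlo]; linarith)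
  have hsψu : ∀ z ∈ Metric.sphere (0 : ℂ) 1, 0 ≤ z.im → ψ z = α ((z.re + 1) / 2) := by
    intro z hz h
    rw [hψu z (Metric.sphere_subset_closedBall hz) h, Function.comp, hsu z hz h, hψ₁u z hz h]
  have hsψl : ∀ z ∈ Metric.sphere (0 : ℂ) 1, z.im ≤ 0 → ψ z = β ((z.re + 1) / 2) := by
    intro z hz h
    rw [hψl z (Metric.sphere_subset_closedBall hz) h, Function.comp, hsl z hz h, hψ₂l z hz h]
  have hre : ∀ z ∈ Metric.sphere (0 : ℂ) 1, (z.re + 1) / 2 ∈ Set.Icc (0 : ℝ) 1 := by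
    intro z hz
    rw [Complex.mem_sphere_one_iff] at hz
    constructor <;> nlinarith [sq_nonneg z.im]
  have himg : ψ '' Metric.closedBall 0 1 = D₁ ∪ D₂ := by
    rw [← hψ₁D, ← hψ₂D]
    ext p
    constructor
    · rintro ⟨z, hz, rfl⟩
      rcases le_total 0 z.im with h | h
      · exact Or.inl ⟨_, hupm z hz h, (hψu z hz h).symm⟩
      · exact Or.inr ⟨_, hlom z hz h, (hψl z hz h).symm⟩
    · rintro (⟨z, hz, rfl⟩ | ⟨z, hz, rfl⟩)
      · have hz' := habs z hz
        have hm := hmem z hz ((z.im + s z) / 2) (by linarith [hsn z]) (by linarith)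
        refine ⟨_, hm, (hψu _ hm (by dsimp only; linarith)).trans (congrArg ψ₁ ?_)⟩
        refine Complex.ext rfl ?_
        have := hext ⟨z.re, (z.im + s z) / 2⟩ z rfl
        simp only [hup, this]
        ring
      · have hz' := habs z hz
        have hm := hmem z hz ((z.im - s z) / 2) (by linarith) (by linarith [hsn z])
        refine ⟨_, hm, (hψl _ hm (by dsimp only; linarith)).trans (congrArg ψ₂ ?_)⟩
        refine Complex.ext rfl ?_
        have := hext ⟨z.re, (z.im - s z) / 2⟩ z rfl
        simp only [hlo, this]
        ring
  have hbd : ψ '' Metric.sphere 0 1 = α '' Set.Icc 0 1 ∪ β '' Set.Icc 0 1 := by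
    ext p
    constructor
    · rintro ⟨z, hz, rfl⟩
      rcases le_total 0 z.im with h | h
      · exact Or.inl ⟨_, hre z hz, (hsψu z hz h).symm⟩
      · exact Or.inr ⟨_, hre z hz, (hsψl z hz h).symm⟩
    · rintro (⟨t, ht, rfl⟩ | ⟨t, ht, rfl⟩)
      · refine ⟨_, hptu t ht, (hsψu _ (hptu t ht) (Real.sqrt_nonneg _)).trans ?_⟩
        rw [hhalf]
      · refine ⟨_, hptl t ht, (hsψl _ (hptl t ht) (neg_nonpos.2 (Real.sqrt_nonneg _))).trans ?_⟩
        rw [hhalf]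
  rw [← himg, ← hbd]
  exact IsDiscWithBoundary.of_continuousOn hψc hψi

/-! ### Cutting cycles open and joining paths to cycles. -/

namespace SimpleGraph.Walk

variable {V : Type*} {G : SimpleGraph V}

/-- A cycle can be cut open at any of its edges. -/
theorem IsCycle.exists_isPath_of_mem_edges {v x y : V} {c : G.Walk v v} (hc : c.IsCycle)
    (h : s(x, y) ∈ c.edges) : ∃ p : G.Walk y x, p.IsPath ∧ s(x, y) ∉ p.edges ∧
      ∀ e, e ∈ c.edges ↔ e = s(x, y) ∨ e ∈ p.edges := by
  classical
  have hx : x ∈ c.support := c.fst_mem_support_of_mem_edges h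
  have key : ∀ c' : G.Walk x x, c'.IsCycle → c'.snd = y → ∃ p : G.Walk y x, p.IsPath ∧
      s(x, y) ∉ p.edges ∧ ∀ e, e ∈ c'.edges ↔ e = s(x, y) ∨ e ∈ p.edges := by
    rintro (_ | ⟨hxy, p⟩) hc' hsnd
    · exact absurd rfl hc'.ne_nil
    · rw [snd_cons] at hsnd
      subst hsnd
      have := (cons_isCycle_iff p hxy).1 hc'
      exact ⟨p, this.1, this.2, fun e => by simp⟩
  have hr : (c.rotate x hx).IsCycle := hc.rotate hx
  have hre : ∀ e, e ∈ (c.rotate x hx).edges ↔ e ∈ c.edges := fun e => (c.rotate_edges x hx).mem_iff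
  have hy : y ∈ (c.rotate x hx).toSubgraph.neighborSet x := by
    rw [Subgraph.mem_neighborSet, adj_toSubgraph_iff_mem_edges, hre]
    exact h
  -- Once the cycle starts at `x`, its neighbour `y` is either the second or the last but one
  -- vertex; in the latter case the cycle is reversed.
  rw [hr.neighborSet_toSubgraph_endpoint] at hy
  rcases hy with hy | hy
  · obtain ⟨p, h1, h2, h3⟩ := key _ hr hy.symm
    exact ⟨p, h1, h2, fun e => (hre e).symm.trans (h3 e)⟩
  · obtain ⟨p, h1, h2, h3⟩ := key _ hr.reverse (by rw [snd_reverse]; exact hy.symm)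
    refine ⟨p, h1, h2, fun e => ?_⟩
    rw [← hre, ← h3, edges_reverse, List.mem_reverse]

/-- Two internally disjoint paths with common end points form a cycle. -/
theorem IsPath.isCycle_append_reverse {x y : V} {p q : G.Walk y x} (hp : p.IsPath) (hq : q.IsPath)
    (hxy : x ≠ y) (hpe : s(x, y) ∉ p.edges) (hqe : s(x, y) ∉ q.edges)
    (h : ∀ z, z ∈ p.support → z ∈ q.support → z = x ∨ z = y) :
    (p.append q.reverse).IsCycle := by
  cases p with
  | nil => exact absurd rfl hxy
  | @cons _ z _ hyz p =>
    rw [cons_isPath_iff] at hp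
    rw [cons_append, cons_isCycle_iff]
    constructor
    · rw [isPath_def, support_append, List.nodup_append']
      refine ⟨hp.1.support_nodup, ?_, ?_⟩
      · exact (hq.reverse.support_nodup).sublist (List.tail_sublist _)
      · intro w hw hw'
        have hnd := hq.reverse.support_nodup
        rw [← cons_tail_support, List.nodup_cons] at hnd
        have hwq : w ∈ q.support := by
          have := List.mem_of_mem_tail hw'
          rwa [support_reverse, List.mem_reverse] at this
        rcases h w (by simp [hw]) hwq with rfl | rfl
        · exact hnd.1 hw'
        · exact hp.2 hw
    · rw [edges_append, List.mem_append, edges_reverse, List.mem_reverse]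
      -- If the first edge `yz` of `p` recurred later in `p`, then `p` would revisit `y`. If it
      -- recurred in `q`, then `z` would be a common vertex, hence `x`, and `q` would use the edge
      -- `xy`.
      rintro (he | he)
      · exact hp.2 (p.fst_mem_support_of_mem_edges he)
      · rcases h z (by simp) (q.snd_mem_support_of_mem_edges he) with rfl | rfl
        · exact hqe (by rwa [Sym2.eq_swap])
        · exact hyz.ne rfl

end SimpleGraph.Walk

/-! ### Edges and walks as point sets, and discs bounded by cycles of the graph. -/

namespace EmbeddedGraph

variable {S : Type*} [TopologicalSpace S] {G : EmbeddedGraph S}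

theorem inter_vertices_eq {e : Set S} (he : e ∈ G.edges) {x y : G.vertices} (hxy : x ≠ y)
    (hx : (x : S) ∈ e) (hy : (y : S) ∈ e) : e ∩ (G.vertices : Set S) = {(x : S), (y : S)} := by
  obtain ⟨a, -, b, -, -, hab⟩ := G.isArc e he
  have hx' : (x : S) ∈ e ∩ (G.vertices : Set S) := ⟨hx, x.2⟩
  have hy' : (y : S) ∈ e ∩ (G.vertices : Set S) := ⟨hy, y.2⟩
  have hne : (x : S) ≠ y := fun h => hxy (Subtype.ext h)
  rw [hab] at hx' hy' ⊢
  rcases hx' with hx' | hx' <;> rcases hy' with hy' | hy'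
  · exact absurd (hx'.trans hy'.symm) hne
  · rw [hx', hy']
  · rw [hx', hy', Set.pair_comm]
  · exact absurd (hx'.trans hy'.symm) hne

theorem eq_or_eq_of_mem {e : Set S} (he : e ∈ G.edges) {x y z : G.vertices} (hxy : x ≠ y)
    (hx : (x : S) ∈ e) (hy : (y : S) ∈ e) (hz : (z : S) ∈ e) : z = x ∨ z = y := by
  have : (z : S) ∈ e ∩ (G.vertices : Set S) := ⟨hz, z.2⟩
  rw [inter_vertices_eq he hxy hx hy] at this
  exact this.imp Subtype.ext Subtype.ext

theorem edge_unique {e e' : Set S} (he : e ∈ G.edges) (he' : e' ∈ G.edges) {x y : G.vertices}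
    (hxy : x ≠ y) (hx : (x : S) ∈ e) (hy : (y : S) ∈ e) (hx' : (x : S) ∈ e') (hy' : (y : S) ∈ e') :
    e = e' :=
  G.simple e he e' he' <| by
    rw [inter_vertices_eq he hxy hx hy, inter_vertices_eq he' hxy hx' hy']

theorem exists_ends {e : Set S} (he : e ∈ G.edges) :
    ∃ x y : G.vertices, x ≠ y ∧ (x : S) ∈ e ∧ (y : S) ∈ e := by
  obtain ⟨a, ha, b, hb, hab, -⟩ := G.isArc e he
  exact ⟨⟨a, ha⟩, ⟨b, hb⟩, fun h => hab.ne (congrArg Subtype.val h), hab.left_mem, hab.right_mem⟩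

theorem isArcBetween_of_mem [T2Space S] {e : Set S} (he : e ∈ G.edges) {x y : G.vertices}
    (hxy : x ≠ y) (hx : (x : S) ∈ e) (hy : (y : S) ∈ e) : IsArcBetween e (x : S) y := by
  obtain ⟨a, ha, b, hb, hab, -⟩ := G.isArc e he
  have hne : (x : S) ≠ y := fun h => hxy (Subtype.ext h)
  have h1 := eq_or_eq_of_mem he hxy hx hy (z := ⟨a, ha⟩) hab.left_mem
  have h2 := eq_or_eq_of_mem he hxy hx hy (z := ⟨b, hb⟩) hab.right_mem
  rcases h1 with h1 | h1 <;> rcases h2 with h2 | h2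
  · exact absurd (congrArg Subtype.val (h1.trans h2.symm)) hab.ne
  · rwa [← h1, ← h2]
  · rw [← h1, ← h2]
    exact hab.symm
  · exact absurd (congrArg Subtype.val (h1.trans h2.symm)) hab.ne

/-- Hence an edge has points that are not vertices and cannot lie in a one-point intersection of
facets. -/
theorem edge_infinite {e : Set S} (he : e ∈ G.edges) : e.Infinite := by
  obtain ⟨a, -, b, -, hab, -⟩ := G.isArc e he
  exact hab.infinite

theorem eq_of_edge_subset {e e' : Set S} (he : e ∈ G.edges) (he' : e' ∈ G.edges) (h : e ⊆ e') :
    e = e' := by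
  obtain ⟨x, y, hxy, hx, hy⟩ := exists_ends he
  exact edge_unique he he' hxy hx hy (h hx) (h hy)

theorem mem_walkEdges_iff {u v : G.vertices} {c : G.edgeGraph.Walk u v} {e : Set S}
    (he : e ∈ G.edges) {x y : G.vertices} (hxy : x ≠ y) (hx : (x : S) ∈ e) (hy : (y : S) ∈ e) :
    e ∈ G.walkEdges c ↔ s(x, y) ∈ c.edges := by
  constructor
  · rintro ⟨-, x', y', h, hx', hy'⟩
    have hne : x' ≠ y' := (c.adj_of_mem_edges h).ne
    have h1 := eq_or_eq_of_mem he hne hx' hy' hx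
    have h2 := eq_or_eq_of_mem he hne hx' hy' hy
    rcases h1 with rfl | rfl <;> rcases h2 with rfl | rfl
    · exact absurd rfl hxy
    · exact h
    · rwa [Sym2.eq_swap]
    · exact absurd rfl hxy
  · exact fun h => ⟨he, x, y, h, hx, hy⟩

theorem walkEdges_subset {u v : G.vertices} (c : G.edgeGraph.Walk u v) :
    G.walkEdges c ⊆ G.edges := fun _ h => h.1

theorem walkEdges_finite {u v : G.vertices} (c : G.edgeGraph.Walk u v) :
    (G.walkEdges c).Finite := G.finite_edges.subset (walkEdges_subset c)

@[simp]
theorem walkEdges_nil {u : G.vertices} :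
    G.walkEdges (SimpleGraph.Walk.nil : G.edgeGraph.Walk u u) = ∅ := by
  simp [walkEdges]

theorem walkEdges_reverse {u v : G.vertices} (c : G.edgeGraph.Walk u v) :
    G.walkEdges c.reverse = G.walkEdges c := by
  simp [walkEdges]

theorem walkEdges_append {u v w : G.vertices} (c : G.edgeGraph.Walk u v)
    (d : G.edgeGraph.Walk v w) : G.walkEdges (c.append d) = G.walkEdges c ∪ G.walkEdges d := by
  ext e
  simp only [walkEdges, SimpleGraph.Walk.edges_append, List.mem_append, Set.mem_ofPred_eq,
    Set.mem_union]
  grind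

theorem walkEdges_cons {u v w : G.vertices} (h : G.edgeGraph.Adj u v) (c : G.edgeGraph.Walk v w)
    {e : Set S} (he : e ∈ G.edges) (hu : (u : S) ∈ e) (hv : (v : S) ∈ e) :
    G.walkEdges (SimpleGraph.Walk.cons h c) = insert e (G.walkEdges c) := by
  ext e'
  by_cases he' : e' ∈ G.edges
  · obtain ⟨x, y, hxy, hx, hy⟩ := exists_ends he'
    rw [Set.mem_insert_iff, mem_walkEdges_iff he' hxy hx hy, mem_walkEdges_iff he' hxy hx hy,
      SimpleGraph.Walk.edges_cons, List.mem_cons]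
    refine or_congr_left ⟨fun hs => ?_, ?_⟩
    · rw [Sym2.eq_iff] at hs
      rcases hs with ⟨rfl, rfl⟩ | ⟨rfl, rfl⟩
      · exact edge_unique he' he hxy hx hy hu hv
      · exact edge_unique he' he hxy hx hy hv hu
    · rintro rfl
      rcases eq_or_eq_of_mem he' hxy hx hy hu with rfl | rfl <;>
        rcases eq_or_eq_of_mem he' hxy hx hy hv with rfl | rfl
      · exact absurd rfl h.ne
      · rfl
      · exact Sym2.eq_swap
      · exact absurd rfl h.ne
  · refine iff_of_false (fun h => he' h.1) ?_
    rintro (rfl | h)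
    · exact he' he
    · exact he' h.1

theorem mem_support_of_mem_walkEdges {u v z : G.vertices} {c : G.edgeGraph.Walk u v} {e : Set S}
    (he : e ∈ G.walkEdges c) (hz : (z : S) ∈ e) : z ∈ c.support := by
  obtain ⟨he, x, y, h, hx, hy⟩ := he
  rcases eq_or_eq_of_mem he (c.adj_of_mem_edges h).ne hx hy hz with rfl | rfl
  · exact c.fst_mem_support_of_mem_edges h
  · exact c.snd_mem_support_of_mem_edges h

theorem exists_mem_walkEdges_of_mem_support {u v z : G.vertices} {c : G.edgeGraph.Walk u v}
    (hc : ¬ c.Nil) (hz : z ∈ c.support) : ∃ e ∈ G.walkEdges c, (z : S) ∈ e := by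
  rw [SimpleGraph.Walk.mem_support_iff_exists_mem_edges_of_not_nil hc] at hz
  obtain ⟨s, hs, hzs⟩ := hz
  obtain ⟨w, rfl⟩ := Sym2.mem_iff_exists.1 hzs
  obtain ⟨-, e, he, hz, hw⟩ := c.adj_of_mem_edges hs
  exact ⟨e, ⟨he, z, w, hs, hz, hw⟩, hz⟩

/-- A trail repeats no edge, and a simple graph has only one arc for each adjacent pair. This
converts the count of free edges into the length of the boundary cycle. -/
theorem ncard_walkEdges {u v : G.vertices} {c : G.edgeGraph.Walk u v} (hc : c.IsTrail) :
    (G.walkEdges c).ncard = c.length := by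
  induction c with
  | nil => simp
  | cons h c ih =>
    rw [SimpleGraph.Walk.isTrail_cons] at hc
    obtain ⟨hne, e, he, hu, hv⟩ := id h
    rw [walkEdges_cons h c he hu hv, Set.ncard_insert_of_notMem _ (walkEdges_finite c), ih hc.1,
      SimpleGraph.Walk.length_cons]
    rw [mem_walkEdges_iff he hne hu hv]
    exact hc.2

/-- The union of the edges of a path is an arc. -/
theorem isArcBetween_of_isPath [T2Space S] {u v : G.vertices} {c : G.edgeGraph.Walk u v}
    (hc : c.IsPath) (huv : u ≠ v) : IsArcBetween (⋃₀ G.walkEdges c) (u : S) v := by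
  induction c with
  | nil => exact absurd rfl huv
  | @cons u w v h c ih =>
    have ht := (SimpleGraph.Walk.isTrail_cons h c).1 hc.isTrail
    rw [SimpleGraph.Walk.cons_isPath_iff] at hc
    obtain ⟨hne, e, he, hu, hw⟩ := id h
    rw [walkEdges_cons h c he hu hw, Set.sUnion_insert]
    have hearc := isArcBetween_of_mem he hne hu hw
    by_cases hwv : w = v
    · subst hwv
      rw [SimpleGraph.Walk.isPath_iff_nil.1 hc.1 |>.eq_nil]
      simpa using hearc
    · refine hearc.trans (ih hc.1 hwv) ?_
      rintro z ⟨hz, e', he', hz'⟩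
      have hee' : e ≠ e' := by
        rintro rfl
        exact ht.2 ((mem_walkEdges_iff he hne hu hw).1 he')
      have hzV := G.inter_subset e he e' he'.1 hee' ⟨hz, hz'⟩
      rcases eq_or_eq_of_mem he hne hu hw (z := ⟨z, hzV⟩) hz with h | h
      · exact absurd (mem_support_of_mem_walkEdges he' hz') (h ▸ hc.2)
      · exact congrArg Subtype.val h

/-- `D` is a disc whose boundary is a cycle of the graph with edge set `E`. -/
def IsPolygonalDisc (G : EmbeddedGraph S) (D : Set S) (E : Set (Set S)) : Prop :=
  ∃ (v : G.vertices) (c : G.edgeGraph.Walk v v), c.IsCycle ∧ G.walkEdges c = E ∧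
    IsDiscWithBoundary D (⋃₀ E)

theorem _root_.IsDiscWithBoundary.subset {D B : Set S} (h : IsDiscWithBoundary D B) : B ⊆ D := by
  obtain ⟨φ, -, rfl, rfl⟩ := h
  exact Set.image_subset_range _ _

/-- Opening the boundary cycle at `e` leaves the complementary boundary arc, in the form needed for
gluing along `e`. -/
theorem IsPolygonalDisc.exists_isPath {D : Set S} {E : Set (Set S)} (h : G.IsPolygonalDisc D E)
    {e : Set S} (he : e ∈ E) {x y : G.vertices} (hxy : x ≠ y) (hx : (x : S) ∈ e)
    (hy : (y : S) ∈ e) : ∃ p : G.edgeGraph.Walk y x, p.IsPath ∧ s(x, y) ∉ p.edges ∧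
      E = insert e (G.walkEdges p) ∧ ∀ z ∈ p.support, (z : S) ∈ D := by
  obtain ⟨v, c, hc, rfl, hD⟩ := h
  obtain ⟨p, hp, hpe, hce⟩ := hc.exists_isPath_of_mem_edges ((mem_walkEdges_iff he.1 hxy hx hy).1 he)
  have hE : G.walkEdges c = insert e (G.walkEdges p) := by
    ext e'
    by_cases he' : e' ∈ G.edges
    · obtain ⟨a, b, hab, ha, hb⟩ := exists_ends he'
      have hadj : G.edgeGraph.Adj x y := ⟨hxy, e, he.1, hx, hy⟩
      rw [← walkEdges_cons hadj p he.1 hx hy, mem_walkEdges_iff he' hab ha hb,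
        mem_walkEdges_iff he' hab ha hb, hce, SimpleGraph.Walk.edges_cons, List.mem_cons]
    · refine iff_of_false (fun h => he' h.1) ?_
      rintro (rfl | h)
      · exact he' he.1
      · exact he' h.1
  refine ⟨p, hp, hpe, hE, fun z hz => hD.subset ?_⟩
  obtain ⟨e', he', hz'⟩ := exists_mem_walkEdges_of_mem_support
    (SimpleGraph.Walk.not_nil_of_ne hxy.symm) hz
  exact ⟨e', hE ▸ Or.inr he', hz'⟩

/-- Gluing two polygonal discs along a common boundary edge. -/
theorem IsPolygonalDisc.union [T2Space S] {D₁ D₂ : Set S} {E₁ E₂ : Set (Set S)}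
    (h₁ : G.IsPolygonalDisc D₁ E₁) (h₂ : G.IsPolygonalDisc D₂ E₂) {e : Set S} (he₁ : e ∈ E₁)
    (he₂ : e ∈ E₂) (hD : D₁ ∩ D₂ = e) : G.IsPolygonalDisc (D₁ ∪ D₂) ((E₁ ∪ E₂) \ {e}) := by
  have he : e ∈ G.edges := by
    obtain ⟨v, c, -, rfl, -⟩ := h₁
    exact he₁.1
  obtain ⟨x, y, hxy, hx, hy⟩ := exists_ends he
  obtain ⟨p, hp, hpe, hE₁, hpD⟩ := h₁.exists_isPath he₁ hxy hx hy
  obtain ⟨q, hq, hqe, hE₂, hqD⟩ := h₂.exists_isPath he₂ hxy hx hy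
  obtain ⟨-, -, -, -, hd₁⟩ := h₁
  obtain ⟨-, -, -, -, hd₂⟩ := h₂
  rw [← mem_walkEdges_iff he hxy hx hy] at hpe hqe
  have hE : (E₁ ∪ E₂) \ {e} = G.walkEdges (p.append q.reverse) := by
    rw [walkEdges_append, walkEdges_reverse, hE₁, hE₂]
    ext e'
    simp only [Set.mem_sdiff, Set.mem_union, Set.mem_insert_iff, Set.mem_singleton_iff]
    constructor
    · tauto
    · rintro (h | h)
      · exact ⟨Or.inl (Or.inr h), fun h' => hpe (h' ▸ h)⟩
      · exact ⟨Or.inr (Or.inr h), fun h' => hqe (h' ▸ h)⟩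
  have hmeet : ∀ r : G.edgeGraph.Walk y x, e ∉ G.walkEdges r →
      ⋃₀ G.walkEdges r ∩ e ⊆ {(y : S), (x : S)} := by
    rintro r hr z ⟨⟨e', he', hz'⟩, hz⟩
    have hne : e ≠ e' := fun h => hr (h ▸ he')
    rw [← inter_vertices_eq he hxy.symm hy hx]
    exact ⟨hz, G.inter_subset e he e' he'.1 hne ⟨hz, hz'⟩⟩
  refine ⟨y, p.append q.reverse, ?_, hE.symm, ?_⟩
  · refine hp.isCycle_append_reverse hq hxy ?_ ?_ fun z hz hz' => ?_
    · rwa [← mem_walkEdges_iff he hxy hx hy]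
    · rwa [← mem_walkEdges_iff he hxy hx hy]
    -- A vertex on both complementary paths lies in `D₁ ∩ D₂ = e`, so the paths meet only at the
    -- ends of `e`.
    · exact eq_or_eq_of_mem he hxy hx hy (hD ▸ ⟨hpD z hz, hqD z hz'⟩)
  · rw [hE, walkEdges_append, walkEdges_reverse, Set.sUnion_union]
    refine IsDiscWithBoundary.union (isArcBetween_of_mem he hxy.symm hy hx)
      (isArcBetween_of_isPath hp hxy.symm) (isArcBetween_of_isPath hq hxy.symm)
      (hmeet p hpe) (hmeet q hqe) ?_ ?_ hD
    · rwa [hE₁, Set.sUnion_insert, Set.union_comm] at hd₁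
    · rwa [hE₂, Set.sUnion_insert, Set.union_comm] at hd₂

end EmbeddedGraph

/-! ### Corners and sides of the standard polygon; facets as polygonal discs. -/

theorem norm_polygonCorner (p j : ℕ) : ‖polygonCorner p j‖ = 1 := Complex.norm_exp_ofReal_mul_I _

theorem polygonCorner_self {p : ℕ} (hp : p ≠ 0) : polygonCorner p p = polygonCorner p 0 := by
  have : (p : ℝ) ≠ 0 := Nat.cast_ne_zero.2 hp
  simp only [polygonCorner, mul_div_assoc, div_self this]
  simp [Complex.exp_two_pi_mul_I]

/-- Equal exponentials have arguments that differ by a multiple of `2π`, so the indices differ by a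
multiple of `p`, which is zero for indices below `p`. -/
theorem polygonCorner_injOn (p : ℕ) : Set.InjOn (polygonCorner p) (Set.Iio p) := by
  intro i hi j hj h
  have hp : (p : ℝ) ≠ 0 := Nat.cast_ne_zero.2 (Nat.ne_zero_of_lt hi)
  obtain ⟨n, hn⟩ := Complex.exp_eq_exp_iff_exists_int.1 h
  have h1 : (2 * Real.pi * i / p : ℝ) = 2 * Real.pi * j / p + n * (2 * Real.pi) := by
    have := congrArg Complex.im hn
    simpa using this
  have h2 : (i : ℝ) = j + n * p := by
    have h3 : 2 * Real.pi * ((i : ℝ) - (j + n * p)) = 0 := by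
      field_simp at h1
      linear_combination 2 * Real.pi * h1
    have := (mul_eq_zero.1 h3).resolve_left Real.two_pi_pos.ne'
    linarith
  have h3 : (i : ℤ) = j + n * p := by exact_mod_cast h2
  simp only [Set.mem_Iio] at hi hj
  have hn0 : n = 0 := by
    by_contra hne
    rcases lt_or_gt_of_ne hne with h | h
    · nlinarith
    · nlinarith
  rw [hn0] at h3
  omega

theorem polygonCorner_mem_polygonSide (p j : ℕ) : polygonCorner p j ∈ polygonSide p j := by
  refine ⟨_, ⟨le_rfl, ?_⟩, rfl⟩
  gcongr
  linarith

theorem polygonCorner_succ_mem_polygonSide (p j : ℕ) :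
    polygonCorner p (j + 1) ∈ polygonSide p j := by
  refine ⟨2 * Real.pi * (j + 1) / p, ⟨?_, le_rfl⟩, by simp [polygonCorner]⟩
  gcongr
  linarith

theorem exists_mem_polygonSide {p : ℕ} (hp : p ≠ 0) {z : ℂ} (hz : ‖z‖ = 1) :
    ∃ j < p, z ∈ polygonSide p j := by
  have hp' : (0 : ℝ) < p := Nat.cast_pos.2 (Nat.pos_of_ne_zero hp)
  have hpi := Real.two_pi_pos
  obtain ⟨θ, h0, h1, rfl⟩ : ∃ θ : ℝ, 0 ≤ θ ∧ θ < 2 * Real.pi ∧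
      Complex.exp ((θ : ℂ) * Complex.I) = z := by
    have hz' : Complex.exp ((z.arg : ℂ) * Complex.I) = z := by
      have := Complex.norm_mul_exp_arg_mul_I z
      rwa [hz, Complex.ofReal_one, one_mul] at this
    rcases le_or_gt 0 z.arg with h | h
    · exact ⟨z.arg, h, by linarith [Complex.arg_le_pi z], hz'⟩
    · refine ⟨z.arg + 2 * Real.pi, by linarith [Complex.neg_pi_lt_arg z], by linarith, ?_⟩
      push_cast
      rw [add_mul, Complex.exp_add, hz', Complex.exp_two_pi_mul_I, mul_one]
  have hq : 0 ≤ θ * p / (2 * Real.pi) := by positivity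
  -- With the argument taken in `[0, 2π)`, the side is found by rounding down in units of `2π / p`.
  refine ⟨⌊θ * p / (2 * Real.pi)⌋₊, ?_, θ, ⟨?_, ?_⟩, rfl⟩
  · rw [Nat.floor_lt hq, div_lt_iff₀ hpi, mul_comm]
    gcongr
  · have := Nat.floor_le hq
    rw [le_div_iff₀ hpi] at this
    rw [div_le_iff₀ hp']
    linarith
  · have := (Nat.lt_floor_add_one (θ * p / (2 * Real.pi))).le
    rw [div_le_iff₀ hpi] at this
    rw [le_div_iff₀ hp']
    linarith

/-- The open disc is dense in the closed disc, and a continuous map from a compact space to a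
Hausdorff space is closed, so it commutes with closure. -/
theorem closure_image_open_disc {S : Type*} [TopologicalSpace S] [T2Space S]
    {φ : Metric.closedBall (0 : ℂ) 1 → S} (hφ : Continuous φ) :
    closure (φ '' {z | ‖(z : ℂ)‖ < 1}) = Set.range φ := by
  rw [hφ.isClosedMap.closure_image_eq_of_continuous hφ, ← Set.image_univ]
  congr 1
  rw [Set.eq_univ_iff_forall]
  intro z
  rw [Topology.IsInducing.subtypeVal.closure_eq_preimage_closure_image]
  have : ((↑) : Metric.closedBall (0 : ℂ) 1 → ℂ) '' {z | ‖(z : ℂ)‖ < 1} = Metric.ball 0 1 := by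
    ext w
    constructor
    · rintro ⟨u, hu, rfl⟩
      exact mem_ball_zero_iff.2 hu
    · intro hw
      exact ⟨⟨w, Metric.ball_subset_closedBall hw⟩, mem_ball_zero_iff.1 hw, rfl⟩
  rw [this, Set.mem_preimage, closure_ball _ one_ne_zero]
  exact z.2

theorem image_Iio_add_one {α : Type*} (f : ℕ → α) (m : ℕ) :
    f '' Set.Iio (m + 1) = insert (f m) (f '' Set.Iio m) := by
  rw [← Set.image_insert_eq]
  congr 1
  ext i
  simp only [Set.mem_Iio, Set.mem_insert_iff]
  omega

namespace EmbeddedGraph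

variable {S : Type*} [TopologicalSpace S] {G : EmbeddedGraph S}

/-- A polygonal facet is a disc that is bounded by the cycle of its edges. -/
theorem isPolygonalDisc_closure [T2Space S] {C : Set S} {p : ℕ} (hp : 3 ≤ p)
    (hCG : Disjoint C G.carrier) (hC : IsOpenPolygon (G.vertices : Set S) G.edges p C) :
    G.IsPolygonalDisc (closure C) {e ∈ G.edges | e ⊆ closure C} := by
  obtain ⟨φ, hφ, hφC, hcorner, hside⟩ := hC
  have hp0 : p ≠ 0 := by omega
  have hcl : closure C = Set.range φ := by
    rw [← hφC, closure_image_open_disc hφ.continuous]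
  have hcm : ∀ j, polygonCorner p j ∈ Metric.closedBall (0 : ℂ) 1 := fun j =>
    mem_closedBall_zero_iff.2 (norm_polygonCorner p j).le
  set side : ℕ → Set S := fun j => φ '' {z | (z : ℂ) ∈ polygonSide p j} with hsd
  have hmod : ∀ j, j % p < p := fun j => Nat.mod_lt _ (by omega)
  -- Indices are reduced modulo `p`, so that `v p = v 0` and the last side closes the cycle.
  set v : ℕ → G.vertices := fun j =>
    ⟨φ ⟨polygonCorner p (j % p), hcm _⟩, hcorner _ (hmod j) _ rfl⟩ with hv
  have hvi : Set.InjOn v (Set.Iio p) := by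
    intro i hi j hj hij
    have h1 := congrArg Subtype.val (hφ.injective (congrArg Subtype.val hij))
    simp only [Nat.mod_eq_of_lt hi, Nat.mod_eq_of_lt hj] at h1
    exact polygonCorner_injOn p hi hj h1
  have hvp : v p = v 0 := by simp [hv]
  have hl : ∀ j < p, (v j : S) ∈ side j := by
    intro j hj
    refine ⟨_, ?_, rfl⟩
    simp only [Set.mem_ofPred_eq, Nat.mod_eq_of_lt hj]
    exact polygonCorner_mem_polygonSide p j
  have hr : ∀ j < p, (v (j + 1) : S) ∈ side j := by
    intro j hj
    refine ⟨_, ?_, rfl⟩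
    have h := polygonCorner_succ_mem_polygonSide p j
    rcases (Nat.succ_le_iff.2 hj).eq_or_lt with h' | h'
    · rw [Nat.succ_eq_add_one] at h'
      simp only [Set.mem_ofPred_eq, h', Nat.mod_self]
      rwa [h', polygonCorner_self hp0] at h
    · simp only [Set.mem_ofPred_eq]
      rwa [Nat.mod_eq_of_lt h']
  have hne : ∀ j < p, v j ≠ v (j + 1) := by
    intro j hj h
    rcases (Nat.succ_le_iff.2 hj).eq_or_lt with h' | h'
    · rw [Nat.succ_eq_add_one] at h'
      rw [h', hvp] at h
      have := hvi hj (by simp only [Set.mem_Iio]; omega) h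
      omega
    · have := hvi hj h' h
      omega
  have hadj : ∀ j < p, G.edgeGraph.Adj (v j) (v (j + 1)) := fun j hj =>
    ⟨hne j hj, side j, hside j hj, hl j hj, hr j hj⟩
  have hpath : ∀ m < p, ∃ q : G.edgeGraph.Walk (v 0) (v m), q.IsPath ∧
      (∀ u ∈ q.support, ∃ i ≤ m, u = v i) ∧ G.walkEdges q = side '' Set.Iio m := by
    intro m
    induction m with
    | zero => exact fun _ => ⟨.nil, .nil, by simp, by simp⟩
    | succ m ih =>
      intro hm
      obtain ⟨q, hq, hqs, hqe⟩ := ih (by omega)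
      refine ⟨q.concat (hadj m (by omega)), hq.concat ?_ _, ?_, ?_⟩
      · intro h
        obtain ⟨i, hi, h⟩ := hqs _ h
        have := hvi hm (by simp only [Set.mem_Iio]; omega) h
        omega
      · intro u hu
        rw [SimpleGraph.Walk.support_concat, List.mem_append,
          List.mem_singleton] at hu
        rcases hu with hu | rfl
        · obtain ⟨i, hi, h⟩ := hqs _ hu
          exact ⟨i, by omega, h⟩
        · exact ⟨m + 1, le_rfl, rfl⟩
      · rw [SimpleGraph.Walk.concat_eq_append, walkEdges_append, hqe,
          walkEdges_cons _ _ (hside m (by omega)) (hl m (by omega)) (hr m (by omega)),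
          walkEdges_nil]
        rw [image_Iio_add_one, Set.union_insert, Set.union_empty]
  obtain ⟨q, hq, -, hqe⟩ := hpath (p - 1) (by omega)
  have hpp : p - 1 + 1 = p := by omega
  have hlast : p - 1 < p := by omega
  have hadj' : G.edgeGraph.Adj (v (p - 1)) (v 0) := by
    have := hadj (p - 1) hlast
    rwa [hpp, hvp] at this
  have hr' : (v 0 : S) ∈ side (p - 1) := by
    have := hr (p - 1) hlast
    rwa [hpp, hvp] at this
  have hsides : {e ∈ G.edges | e ⊆ closure C} = side '' Set.Iio p := by
    ext e
    constructor
    · rintro ⟨he, heC⟩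
      -- A point of `e` that is not a vertex is on the graph, hence outside the open cell, so it
      -- lies on a side. Two edges that share such a point coincide.
      obtain ⟨z, hz, hzV⟩ := ((edge_infinite he).sdiff G.vertices.finite_toSet).nonempty
      have hzC := heC hz
      rw [hcl] at hzC
      obtain ⟨u, rfl⟩ := hzC
      have hu : ‖(u : ℂ)‖ = 1 := by
        refine (mem_closedBall_zero_iff.1 u.2).eq_of_not_lt fun h => ?_
        exact Set.disjoint_left.1 hCG (hφC ▸ ⟨u, h, rfl⟩) (Or.inr ⟨e, he, hz⟩)
      obtain ⟨j, hj, huj⟩ := exists_mem_polygonSide hp0 hu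
      refine ⟨j, hj, ?_⟩
      by_contra h
      exact hzV (G.inter_subset _ (hside j hj) e he h ⟨⟨u, huj, rfl⟩, hz⟩)
    · rintro ⟨j, hj, rfl⟩
      exact ⟨hside j hj, hcl ▸ Set.image_subset_range _ _⟩
  refine ⟨_, .cons hadj' q, ?_, ?_, φ, hφ, hcl.symm, ?_⟩
  · rw [SimpleGraph.Walk.cons_isCycle_iff]
    refine ⟨hq, fun h => ?_⟩
    rw [← mem_walkEdges_iff (hside _ hlast) hadj'.1 (hl _ hlast) hr', hqe] at h
    obtain ⟨i, hi, h⟩ := h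
    simp only [Set.mem_Iio] at hi
    -- If the closing side equalled an earlier side `i`, then `i` and `i + 1` would both be among `p
    -- - 1` and `0`. This forces `p = 2`, contrary to `3 ≤ p`.
    have h1 := eq_or_eq_of_mem (hside _ hlast) hadj'.1 (hl _ hlast) hr'
      (z := v (i + 1)) (h ▸ hr i (by omega))
    have h2 := eq_or_eq_of_mem (hside _ hlast) hadj'.1 (hl _ hlast) hr'
      (z := v i) (h ▸ hl i (by omega))
    have inj : ∀ a < p, ∀ b < p, v a = v b → a = b := fun a ha b hb h => hvi ha hb h
    have e1 := h1.imp (inj _ (by omega) _ hlast) (inj _ (by omega) _ (by omega))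
    have e2 := h2.imp (inj _ (by omega) _ hlast) (inj _ (by omega) _ (by omega))
    omega
  · rw [walkEdges_cons hadj' q (hside _ hlast) (hl _ hlast) hr', hqe, hsides]
    have := image_Iio_add_one side (p - 1)
    rw [hpp] at this
    exact this.symm
  · rw [hsides, Set.sUnion_image]
    ext z
    simp only [Set.mem_iUnion, Set.mem_Iio, exists_prop]
    constructor
    · rintro ⟨u, hu, rfl⟩
      obtain ⟨j, hj, huj⟩ := exists_mem_polygonSide hp0 hu
      exact ⟨j, hj, u, huj, rfl⟩
    · rintro ⟨j, hj, u, huj, rfl⟩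
      refine ⟨u, ?_, rfl⟩
      obtain ⟨θ, -, h⟩ := huj
      rw [Set.mem_ofPred_eq, ← h]
      exact Complex.norm_exp_ofReal_mul_I θ

end EmbeddedGraph

theorem PolyhedralMap.isPolygonalDisc_facet {S : Type*} [TopologicalSpace S] [T2Space S]
    (K : PolyhedralMap S) {F : Set S} (hF : F ∈ K.facets) :
    K.IsPolygonalDisc F {e ∈ K.edges | e ⊆ F} := by
  obtain ⟨C, hC, rfl⟩ := hF
  obtain ⟨p, hp, hCp⟩ := K.polygonal C hC
  refine EmbeddedGraph.isPolygonalDisc_closure hp ?_ hCp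
  obtain ⟨x, -, rfl⟩ := hC
  exact Set.disjoint_left.2 fun z hz => connectedComponentIn_subset _ _ hz

/-! ### Induction over trees by adding leaves. -/

/-- A tree is built up from any single vertex by adding leaves. -/
theorem SimpleGraph.IsTree.induction_insert_leaf {V : Type*} [Finite V] {G : SimpleGraph V}
    (hG : G.IsTree) {P : Set V → Prop} (single : ∀ r, P {r})
    (step : ∀ W u v, u ∈ W → v ∉ W → G.Adj u v →
      (∀ h ∈ W, ∀ p : G.Walk h v, u ∈ p.support) → P W → P (insert v W)) : P Set.univ := by
  classical
  -- The induction is on the number of missing vertices, with the extra invariant that `W` is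
  -- connected by paths inside itself.
  have key : ∀ n, ∀ W : Set V, Wᶜ.ncard = n → P W → W.Nonempty →
      (∀ a ∈ W, ∀ b ∈ W, ∃ p : G.Walk a b, p.IsPath ∧ ∀ z ∈ p.support, z ∈ W) →
      P Set.univ := by
    intro n
    induction n with
    | zero =>
      intro W hW hP _ _
      rw [Set.ncard_eq_zero, Set.compl_empty_iff] at hW
      rwa [← hW]
    | succ n ih =>
      intro W hW hP hne hconn
      obtain ⟨b, hb⟩ : Wᶜ.Nonempty := by
        rw [← Set.ncard_pos, hW]
        exact Nat.succ_pos n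
      obtain ⟨a, ha⟩ := hne
      obtain ⟨w⟩ := hG.1.preconnected a b
      obtain ⟨d, -, hu, hv⟩ := w.exists_boundary_dart W ha hb
      have hpath : ∀ h ∈ W, ∃ p : G.Walk h d.snd, p.IsPath ∧ d.fst ∈ p.support ∧
          ∀ z ∈ p.support, z ∈ insert d.snd W := by
        intro h hh
        obtain ⟨q, hq, hqW⟩ := hconn h hh d.fst hu
        refine ⟨q.concat d.adj, hq.concat (fun hmem => hv (hqW _ hmem)) d.adj, ?_, ?_⟩
        · simp [Walk.support_concat]
        · intro z hz
          rw [Walk.support_concat, List.mem_append, List.mem_singleton] at hz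
          exact hz.elim (fun hz => Or.inr (hqW z hz)) Or.inl
      refine ih (insert d.snd W) ?_ (step W d.fst d.snd hu hv d.adj ?_ hP) ⟨a, Or.inr ha⟩ ?_
      · have h1 := Set.ncard_add_ncard_compl (insert d.snd W)
        have h2 := Set.ncard_add_ncard_compl W
        rw [Set.ncard_insert_of_notMem hv] at h1
        omega
      · intro h hh p
        obtain ⟨q, hq, hqu, -⟩ := hpath h hh
        -- The shortcut of any walk from `h` to the new leaf is the unique path of the tree, and
        -- that path goes through `d.fst`.
        have := congrArg Subtype.val ((hG.2.subsingleton_path h d.snd).elim ⟨q, hq⟩ ⟨p.bypass, p.bypass_isPath⟩)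
        simp only at this
        exact p.support_bypass_subset_support (this ▸ hqu)
      · rintro x (rfl | hx) y (rfl | hy)
        · exact ⟨.nil, .nil, by simp⟩
        · obtain ⟨p, hp, -, hpW⟩ := hpath y hy
          exact ⟨p.reverse, hp.reverse, by simpa using hpW⟩
        · obtain ⟨p, hp, -, hpW⟩ := hpath x hx
          exact ⟨p, hp, hpW⟩
        · obtain ⟨p, hp, hpW⟩ := hconn x hx y hy
          exact ⟨p, hp, fun z hz => Or.inr (hpW z hz)⟩
  obtain ⟨r⟩ := hG.1.nonempty
  refine key _ {r} rfl (single r) ⟨r, rfl⟩ ?_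
  rintro a rfl b rfl
  exact ⟨.nil, .nil, by simp⟩

/-! ### Duality, free edges and the growth of the disc. -/

theorem EmbeddedGraph.degree_eq_ncard {S : Type*} [TopologicalSpace S] (G : EmbeddedGraph S)
    (v : G.vertices) : G.degree v = {e ∈ G.edges | (v : S) ∈ e}.ncard := by
  refine Set.ncard_congr (fun u hu => Exists.choose (SimpleGraph.mem_neighborSet _ _ _ |>.1 hu).2)
    ?_ ?_ ?_
  · intro u hu
    have h := Exists.choose_spec (SimpleGraph.mem_neighborSet _ _ _ |>.1 hu).2
    exact ⟨h.1, h.2.1⟩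
  · intro a b ha hb hab
    have h := Exists.choose_spec (SimpleGraph.mem_neighborSet _ _ _ |>.1 ha).2
    have h' := Exists.choose_spec (SimpleGraph.mem_neighborSet _ _ _ |>.1 hb).2
    rw [← hab] at h'
    exact ((eq_or_eq_of_mem h.1 ha.1 h.2.1 h.2.2 h'.2.2).resolve_left hb.1.symm).symm
  · rintro e ⟨he, hv⟩
    obtain ⟨u, hvu, hu⟩ : ∃ u : G.vertices, v ≠ u ∧ (u : S) ∈ e := by
      obtain ⟨x, y, hxy, hx, hy⟩ := exists_ends he
      by_cases h : v = x
      · exact ⟨y, h ▸ hxy, hy⟩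
      · exact ⟨x, h, hx⟩
    have hadj : G.edgeGraph.Adj v u := ⟨hvu, e, he, hv, hu⟩
    have h := Exists.choose_spec hadj.2
    exact ⟨u, hadj, edge_unique h.1 he hvu h.2.1 h.2.2 hv hu⟩

namespace PolyhedralMap.Duality

variable {S : Type*} [TopologicalSpace S] {K M : PolyhedralMap S} (δ : K.Duality M)

/-- The facet of `K` that is dual to a vertex of `M`. -/
def dualFacet (v : M.vertices) : Set S := δ.facetEquiv.symm v

theorem dualFacet_mem (v : M.vertices) : δ.dualFacet v ∈ K.facets := (δ.facetEquiv.symm v).2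

theorem dualFacet_injective : Function.Injective δ.dualFacet :=
  Subtype.val_injective.comp δ.facetEquiv.symm.injective

theorem edge_subset_dualFacet_iff (e : K.edges) (v : M.vertices) :
    (e : Set S) ⊆ δ.dualFacet v ↔ (v : S) ∈ (δ.edgeEquiv e : Set S) := by
  rw [dualFacet, δ.edge_subset_iff, Equiv.apply_symm_apply]

theorem mem_dualFacet_iff (w : K.vertices) (v : M.vertices) :
    (w : S) ∈ δ.dualFacet v ↔ (v : S) ∈ (δ.vertexEquiv w : Set S) := by
  rw [dualFacet, δ.mem_facet_iff, Equiv.apply_symm_apply]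

/-- An edge of `K` lies on no third facet because its dual edge has only two end vertices. -/
theorem eq_or_eq_of_edge_subset {e : Set S} (he : e ∈ K.edges) {a b c : M.vertices} (hab : a ≠ b)
    (ha : e ⊆ δ.dualFacet a) (hb : e ⊆ δ.dualFacet b) (hc : e ⊆ δ.dualFacet c) :
    c = a ∨ c = b := by
  rw [δ.edge_subset_dualFacet_iff ⟨e, he⟩] at ha hb hc
  exact EmbeddedGraph.eq_or_eq_of_mem (δ.edgeEquiv ⟨e, he⟩).2 hab ha hb hc

theorem exists_edge_of_adj {a b : M.vertices} (h : M.edgeGraph.Adj a b) :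
    ∃ e ∈ K.edges, e ⊆ δ.dualFacet a ∧ e ⊆ δ.dualFacet b := by
  obtain ⟨-, e, he, ha, hb⟩ := h
  refine ⟨δ.edgeEquiv.symm ⟨e, he⟩, Subtype.property _, ?_, ?_⟩ <;>
    simpa [δ.edge_subset_dualFacet_iff]

theorem degree_eq_facetLength (v : M.vertices) : M.degree v = K.facetLength (δ.dualFacet v) := by
  rw [M.degree_eq_ncard, EmbeddedGraph.facetLength]
  symm
  refine Set.ncard_congr (fun e he => (δ.edgeEquiv ⟨e, he.1⟩ : Set S)) ?_ ?_ ?_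
  · exact fun e he => ⟨Subtype.property _, (δ.edge_subset_dualFacet_iff ⟨e, he.1⟩ v).1 he.2⟩
  · intro a b ha hb h
    exact congrArg Subtype.val (δ.edgeEquiv.injective (Subtype.ext h))
  · rintro e ⟨he, hv⟩
    refine ⟨δ.edgeEquiv.symm ⟨e, he⟩, ⟨Subtype.property _, ?_⟩, by simp⟩
    simpa [δ.edge_subset_dualFacet_iff]

/-- The edges that lie in exactly one of the facets dual to the vertices in `W`. -/
def freeEdgesOf (W : Set M.vertices) : Set (Set S) :=
  {e ∈ K.edges | ∃! v, v ∈ W ∧ e ⊆ δ.dualFacet v}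

theorem freeEdgesOf_finite (W : Set M.vertices) : (δ.freeEdgesOf W).Finite :=
  K.finite_edges.subset fun _ h => h.1

theorem freeEdgesOf_singleton (v : M.vertices) :
    δ.freeEdgesOf {v} = {e ∈ K.edges | e ⊆ δ.dualFacet v} := by
  ext e
  simp only [freeEdgesOf, Set.mem_singleton_iff, Set.mem_ofPred_eq]
  refine and_congr_right fun _ => ⟨?_, fun h => ⟨v, ⟨rfl, h⟩, fun _ h => h.1⟩⟩
  rintro ⟨_, ⟨rfl, h⟩, -⟩
  exact h

/-- The intersection contains the infinite set `e`, so it is an edge and not a vertex; an edge that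
contains another edge equals it. -/
theorem dualFacet_inter_eq {a b : M.vertices} (hab : a ≠ b) {e : Set S} (he : e ∈ K.edges)
    (ha : e ⊆ δ.dualFacet a) (hb : e ⊆ δ.dualFacet b) : δ.dualFacet a ∩ δ.dualFacet b = e := by
  have hsub : e ⊆ δ.dualFacet a ∩ δ.dualFacet b := Set.subset_inter ha hb
  have hinf := EmbeddedGraph.edge_infinite he
  rcases K.polyhedral _ (δ.dualFacet_mem a) _ (δ.dualFacet_mem b)
    (δ.dualFacet_injective.ne hab) (hinf.nonempty.mono hsub) with ⟨w, -, hw⟩ | h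
  · exact absurd (Set.finite_singleton w) (hw ▸ hinf.mono hsub)
  · exact (EmbeddedGraph.eq_of_edge_subset he h hsub).symm

/-- Adding the facet dual to a leaf to a disc of facets. -/
theorem isPolygonalDisc_insert [T2Space S] {W : Set M.vertices} {u v : M.vertices} (hu : u ∈ W)
    (hv : v ∉ W) (hadj : M.edgeGraph.Adj u v)
    (hmem : ∀ h ∈ W, ∀ w : K.vertices, (w : S) ∈ δ.dualFacet h → (w : S) ∈ δ.dualFacet v →
      (w : S) ∈ δ.dualFacet u)
    (hW : K.IsPolygonalDisc (⋃₀ (δ.dualFacet '' W)) (δ.freeEdgesOf W)) :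
    K.IsPolygonalDisc (⋃₀ (δ.dualFacet '' insert v W)) (δ.freeEdgesOf (insert v W)) ∧
      (δ.freeEdgesOf (insert v W)).ncard + 2 = (δ.freeEdgesOf W).ncard + M.degree v := by
  obtain ⟨e, he, heu, hev⟩ := δ.exists_edge_of_adj hadj
  have hne : ∀ h ∈ W, h ≠ v := fun h hh h' => hv (h' ▸ hh)
  have hinter := δ.dualFacet_inter_eq hadj.1 he heu hev
  -- Each intersection with an old facet is a vertex or an edge. By `hmem` its vertices lie on the
  -- facet of `u`, hence on `e`; an edge with both ends on `e` is `e`.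
  have hD : ⋃₀ (δ.dualFacet '' W) ∩ δ.dualFacet v = e := by
    refine Set.Subset.antisymm ?_ fun z hz => ⟨⟨_, ⟨u, hu, rfl⟩, heu hz⟩, hev hz⟩
    rintro z ⟨⟨_, ⟨h, hh, rfl⟩, hz⟩, hz'⟩
    rcases K.polyhedral _ (δ.dualFacet_mem h) _ (δ.dualFacet_mem v)
      (δ.dualFacet_injective.ne (hne h hh)) ⟨z, hz, hz'⟩ with ⟨w, hwK, hw⟩ | he'
    · have hzw : z = w := hw.subset ⟨hz, hz'⟩
      subst hzw
      rw [← hinter]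
      exact ⟨hmem h hh ⟨z, hwK⟩ hz hz', hz'⟩
    · obtain ⟨x, y, hxy, hx, hy⟩ := EmbeddedGraph.exists_ends he'
      have hx' : (x : S) ∈ e := hinter ▸ ⟨hmem h hh x hx.1 hx.2, hx.2⟩
      have hy' : (y : S) ∈ e := hinter ▸ ⟨hmem h hh y hy.1 hy.2, hy.2⟩
      rw [EmbeddedGraph.edge_unique he he' hxy hx' hy' hx hy]
      exact ⟨hz, hz'⟩
  have honly : ∀ e' ∈ K.edges, e' ⊆ δ.dualFacet v → ∀ h ∈ W, e' ⊆ δ.dualFacet h → e' = e := by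
    intro e' he' hv' h hh hh'
    refine EmbeddedGraph.eq_of_edge_subset he' he fun z hz => ?_
    rw [← hD]
    exact ⟨⟨_, ⟨h, hh, rfl⟩, hh' hz⟩, hv' hz⟩
  have heW : e ∈ δ.freeEdgesOf W :=
    ⟨he, u, ⟨hu, heu⟩, fun h hh => (δ.eq_or_eq_of_edge_subset he hadj.1 heu hev hh.2).resolve_right
      (hne h hh.1)⟩
  set E : Set (Set S) := {e ∈ K.edges | e ⊆ δ.dualFacet v} with hE
  have heE : e ∈ E := ⟨he, hev⟩
  -- Only `e` is shared with the old facets, so it alone stops being free, and all other edges of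
  -- the new facet become free.
  have hfree : δ.freeEdgesOf (insert v W) = (δ.freeEdgesOf W ∪ E) \ {e} := by
    ext e'
    constructor
    · rintro ⟨he', h, ⟨hh, hh'⟩, huniq⟩
      refine ⟨?_, ?_⟩
      · rcases hh with rfl | hh
        · exact Or.inr ⟨he', hh'⟩
        · exact Or.inl ⟨he', h, ⟨hh, hh'⟩, fun b hb => huniq b ⟨Or.inr hb.1, hb.2⟩⟩
      · rintro rfl
        exact hadj.1 ((huniq u ⟨Or.inr hu, heu⟩).trans (huniq v ⟨Or.inl rfl, hev⟩).symm)
    · rintro ⟨⟨he', h, ⟨hh, hh'⟩, huniq⟩ | ⟨he', hv'⟩, hne'⟩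
      · refine ⟨he', h, ⟨Or.inr hh, hh'⟩, ?_⟩
        rintro b ⟨rfl | hb, hb'⟩
        · exact absurd (honly e' he' hb' h hh hh') hne'
        · exact huniq b ⟨hb, hb'⟩
      · refine ⟨he', v, ⟨Or.inl rfl, hv'⟩, ?_⟩
        rintro b ⟨rfl | hb, hb'⟩
        · rfl
        · exact absurd (honly e' he' hv' b hb hb') hne'
  have hEW : δ.freeEdgesOf W ∩ E = {e} := by
    refine Set.Subset.antisymm ?_ (Set.singleton_subset_iff.2 ⟨heW, heE⟩)
    rintro e' ⟨⟨he', h, ⟨hh, hh'⟩, -⟩, -, hv'⟩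
    exact honly e' he' hv' h hh hh'
  have hEfin : E.Finite := K.finite_edges.subset fun _ h => h.1
  constructor
  · rw [hfree, Set.image_insert_eq, Set.sUnion_insert, Set.union_comm]
    exact hW.union (K.isPolygonalDisc_facet (δ.dualFacet_mem v)) heW heE hD
  · have h1 := Set.ncard_union_add_ncard_inter _ _ (δ.freeEdgesOf_finite W) hEfin
    rw [hEW, Set.ncard_singleton] at h1
    -- The edge `e` is lost twice: once as the overlap of the two edge sets and once by its removal
    -- from their union.
    have h2 := Set.ncard_sdiff_singleton_add_one (Set.mem_union_left E heW)
      ((δ.freeEdgesOf_finite W).union hEfin)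
    have h3 : M.degree v = E.ncard := δ.degree_eq_facetLength v
    rw [hfree]
    omega

theorem dualFacets_eq_image (T : M.edgeGraph.Subgraph) :
    δ.dualFacets T = δ.dualFacet '' T.verts := by
  ext F
  constructor
  · rintro ⟨hF, h⟩
    exact ⟨_, h, by simp [dualFacet]⟩
  · rintro ⟨v, hv, rfl⟩
    exact ⟨δ.dualFacet_mem v, by simpa [dualFacet] using hv⟩

/-- Counting by vertices of `M` instead of by facets of `K` changes nothing, as `dualFacet` is
injective. -/
theorem freeEdges_eq (T : M.edgeGraph.Subgraph) : δ.freeEdges T = δ.freeEdgesOf T.verts := by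
  ext e
  rw [freeEdges, freeEdgesOf, δ.dualFacets_eq_image]
  refine and_congr_right fun _ => ⟨?_, ?_⟩
  · rintro ⟨_, ⟨⟨v, hv, rfl⟩, hev⟩, huniq⟩
    exact ⟨v, ⟨hv, hev⟩, fun b hb => δ.dualFacet_injective (huniq _ ⟨⟨b, hb.1, rfl⟩, hb.2⟩)⟩
  · rintro ⟨v, ⟨hv, hev⟩, huniq⟩
    refine ⟨δ.dualFacet v, ⟨⟨v, hv, rfl⟩, hev⟩, ?_⟩
    rintro _ ⟨⟨b, hb, rfl⟩, hb'⟩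
    rw [huniq b ⟨hb, hb'⟩]

/-- The union of the facets dual to a proper tree is a polygonal disc. -/
theorem isPolygonalDisc_dualUnion [T2Space S] {n : ℕ} {T : M.edgeGraph.Subgraph}
    (hT : M.IsProperTree n T) : K.IsPolygonalDisc (δ.dualUnion T) (δ.freeEdges T) ∧
      (δ.freeEdges T).ncard + 2 * T.verts.ncard = (∑ᶠ v ∈ T.verts, M.degree v) + 2 := by
  have key := hT.isTree.induction_insert_leaf
    -- The count is `#free = Σ deg - 2(#W - 1)`, written without subtraction in `ℕ`.
    (P := fun W => K.IsPolygonalDisc (⋃₀ (δ.dualFacet '' (Subtype.val '' W)))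
        (δ.freeEdgesOf (Subtype.val '' W)) ∧
      (δ.freeEdgesOf (Subtype.val '' W)).ncard + 2 * (Subtype.val '' W).ncard =
        (∑ᶠ v ∈ Subtype.val '' W, M.degree v) + 2) ?_ ?_
  · rw [Set.image_univ, Subtype.range_coe] at key
    rwa [dualUnion, δ.freeEdges_eq, δ.dualFacets_eq_image]
  · intro r
    rw [Set.image_singleton, freeEdgesOf_singleton, Set.image_singleton, Set.sUnion_singleton,
      finsum_mem_singleton, Set.ncard_singleton, δ.degree_eq_facetLength]
    exact ⟨K.isPolygonalDisc_facet (δ.dualFacet_mem _), rfl⟩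
  · rintro W u v hu hv hadj hpath ⟨hdisc, hcard⟩
    have hvW : (v : M.vertices) ∉ Subtype.val '' W := by
      rintro ⟨v', hv', h⟩
      exact hv (Subtype.ext h ▸ hv')
    have hmem : ∀ h ∈ Subtype.val '' W, ∀ w : K.vertices, (w : S) ∈ δ.dualFacet h →
        (w : S) ∈ δ.dualFacet v → (w : S) ∈ δ.dualFacet u := by
      rintro _ ⟨h, hh, rfl⟩ w hwh hwv
      rw [δ.mem_dualFacet_iff] at hwh hwv ⊢
      -- Condition 2 is applied to the facet of `M` dual to `w`. The path it yields stays in the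
      -- boundary of that facet and, since `v` is a leaf, contains `u`; so `w` lies on the facet of
      -- `u`.
      obtain ⟨p, -, hpF, hpT⟩ := hT.joined _ (δ.vertexEquiv w).2 h h.2 v v.2 hwh hwv
      have hu' : u ∈ (p.mapToSubgraph.map (SimpleGraph.Subgraph.inclusion hpT)).support :=
        hpath h hh _
      rw [SimpleGraph.Walk.support_map, List.mem_map] at hu'
      obtain ⟨z, -, rfl⟩ := hu'
      exact hpF.1 z.2
    obtain ⟨h1, h2⟩ := δ.isPolygonalDisc_insert (Set.mem_image_of_mem _ hu) hvW
      (T.adj_sub hadj) hmem hdisc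
    rw [Set.image_insert_eq]
    refine ⟨h1, ?_⟩
    have hfin : (Subtype.val '' W).Finite := Set.toFinite _
    rw [finsum_mem_insert _ hvW hfin, Set.ncard_insert_of_notMem hvW hfin]
    omega

end PolyhedralMap.Duality

/-! ### The Hamiltonian cycle and the equivelar count. -/

theorem mainTheorem4 {S : Type*} [TopologicalSpace S] [T2Space S] [CompactSpace S]
    [ConnectedSpace S] [ChartedSpace (EuclideanSpace ℝ (Fin 2)) S] [DecidableEq S]
    (K M : PolyhedralMap S) (δ : K.Duality M) (T : M.edgeGraph.Subgraph)
    (hT : M.IsProperTree K.vertices.card T) :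
    (∃ (v : K.vertices) (c : K.edgeGraph.Walk v v), c.IsHamiltonianCycle ∧
      IsDiscWithBoundary (δ.dualUnion T) (⋃₀ K.walkEdges c) ∧
      K.walkEdges c = δ.freeEdges T) ∧
    (δ.freeEdges T).ncard = K.vertices.card ∧
    (∀ p q : ℕ, K.IsEquivelar p q →
      (T.verts.ncard : ℤ) * ((p : ℤ) - 2) = (K.vertices.card : ℤ) - 2) := by
  obtain ⟨⟨v, c, hc, hcE, hD⟩, hcard⟩ := δ.isPolygonalDisc_dualUnion hT
  have hdeg := hT.degree_sum
  -- The degree sum cancels between the leaf count and condition 1.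
  have hn : (δ.freeEdges T).ncard = K.vertices.card := by omega
  refine ⟨⟨v, c, ?_, hcE ▸ hD, hcE⟩, hn, fun p q hpq => ?_⟩
  -- A cycle whose length is the number of vertices visits all of them.
  · rw [SimpleGraph.Walk.isHamiltonianCycle_iff_isCycle_and_length_eq]
    refine ⟨hc, ?_⟩
    rw [← EmbeddedGraph.ncard_walkEdges hc.isTrail, hcE, hn, Fintype.card_coe]
  · have hsum : ∑ᶠ v ∈ T.verts, M.degree v = p * T.verts.ncard := by
      rw [← finsum_one, mul_finsum_mem' _ _ (Set.toFinite _)]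
      refine finsum_mem_congr rfl fun v _ => ?_
      rw [δ.degree_eq_facetLength, hpq.2.2.1 _ (δ.dualFacet_mem v), mul_one]
    rw [hsum] at hdeg
    push_cast at hdeg
    linear_combination hdeg
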